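/- Let $n\ge 2$. Let $D\subset\mathbb{R}^n$ be a bounded domain and $s:D\to[1,\infty)$ a function. We say that $D$ is an $s(\cdot)$-John domain with John constants $0<\alpha\le\beta<\infty$ and John center $x_0\in D$ if every $x\in D$ can be joined to $x_0$ by a rectifiable curve $\gamma_x:[0,\ell(\gamma_x)]\to D$, parametrized by arc length, with $\gamma_x(0)=x$, $\gamma_x(\ell(\gamma_x))=x_0$, $\ell(\gamma_x)\le\beta$ and $$t^{s(x)}\le\frac{\beta}{\alpha}\,\operatorname{dist}(\gamma_x(t),\partial D)\quad\text{for all } t\in[0,\ell(\gamma_x)].$$ Let $L^1_1(D)$ be the space of all $u\in W^{1,1}_{\mathrm{loc}}(D)$ whose distributional gradient satisfies $|\nabla u|\in L^1(D)$. Let $D$ be an $s(\cdot)$-John domain with John constants $\alpha,\beta$ and John center $x_0$, let $S<\infty$ be such that $s(x)\le S$ for almost every $x\in D$ (for instance $S=s^+:=\operatorname{ess\,sup}_{D}s$ if this is finite), and put $B:=B(x_0,\operatorname{dist}(x_0,\partial D))$. Then there is a constant $c>0$, depending only on $n$, $\alpha$, $\beta$, $S$ and $\operatorname{dist}(x_0,\partial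 D)$, such that every $u\in L^1_1(D)$ is integrable over $B$ and, with $u_B:=\frac{1}{|B|}\int_B u(y)\,dy$, $$|u(x)-u_B|\le c\int_D\frac{|\nabla u(y)|}{|x-y|^{s(x)(n-1)}}\,dy\quad\text{for almost every } x\in D,$$ where the right-hand side takes values in $[0,\infty]$. -/

import Mathlib

open MeasureTheory Set
open scoped ContDiff ENNReal

/-- `D ⊆ ℝⁿ` is an `s(·)`-John domain with John constants `α, β` and John center `x₀`.
Only the values of `s` on `D` matter; `ℓ` is the length of the John curve `γ` of `x`,
which is parametrized by arc length. -/
structure IsVariableJohnDomain {n : ℕ} (D : Set (EuclideanSpace ℝ (Fin n)))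
    (s : EuclideanSpace ℝ (Fin n) → ℝ) (α β : ℝ) (x₀ : EuclideanSpace ℝ (Fin n)) : Prop where
  isOpen : IsOpen D
  isConnected : IsConnected D
  isBounded : Bornology.IsBounded D
  one_le : ∀ x ∈ D, 1 ≤ s x
  pos : 0 < α
  le : α ≤ β
  center_mem : x₀ ∈ D
  exists_curve : ∀ x ∈ D, ∃ (ℓ : ℝ) (γ : ℝ → EuclideanSpace ℝ (Fin n)),
    0 ≤ ℓ ∧ ℓ ≤ β ∧ HasUnitSpeedOn γ (Icc 0 ℓ) ∧ MapsTo γ (Icc 0 ℓ) D ∧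
    γ 0 = x ∧ γ ℓ = x₀ ∧
    ∀ t ∈ Icc 0 ℓ, t ^ s x ≤ β / α * Metric.infDist (γ t) (frontier D)

/-- `u ∈ W^{1,1}_loc(D)` and `g` is (a representative of) the distributional gradient of `u`
in the open set `D`. -/
structure HasWeakGradient {n : ℕ} (D : Set (EuclideanSpace ℝ (Fin n)))
    (u : EuclideanSpace ℝ (Fin n) → ℝ)
    (g : EuclideanSpace ℝ (Fin n) → EuclideanSpace ℝ (Fin n)) : Prop where
  locallyIntegrable : LocallyIntegrableOn u D
  locallyIntegrable_grad : LocallyIntegrableOn g D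
  integral_eq : ∀ φ : EuclideanSpace ℝ (Fin n) → ℝ, ContDiff ℝ ∞ φ → HasCompactSupport φ →
    tsupport φ ⊆ D → ∀ v : EuclideanSpace ℝ (Fin n),
    ∫ x in D, u x * fderiv ℝ φ x v = - ∫ x in D, inner ℝ (g x) v * φ x

/-- `u ∈ L¹₁(D)`, that is, `u ∈ W^{1,1}_loc(D)` and `|∇u| ∈ L¹(D)`, with `∇u = g`. -/
structure MemL11WithGradient {n : ℕ} (D : Set (EuclideanSpace ℝ (Fin n)))
    (u : EuclideanSpace ℝ (Fin n) → ℝ)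
    (g : EuclideanSpace ℝ (Fin n) → EuclideanSpace ℝ (Fin n)) : Prop where
  hasWeakGradient : HasWeakGradient D u g
  integrable_grad : IntegrableOn g D

/-- The potential `∫_D |f(y)| / |x - y|^{s(x)(n-1)} dy`, with values in `[0, ∞]`. -/
noncomputable def variableRieszPotential {n : ℕ} (D : Set (EuclideanSpace ℝ (Fin n)))
    (s f : EuclideanSpace ℝ (Fin n) → ℝ) (x : EuclideanSpace ℝ (Fin n)) : ℝ≥0∞ :=
  ∫⁻ y in D, ENNReal.ofReal (|f y| / dist x y ^ (s x * ((n : ℝ) - 1)))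

/-! The function u is replaced by its means against a smooth kernel carried by a ball whose centre
and radius vary linearly in time. The kernel solves a continuity equation whose velocity field is
affine, so the definition of the weak gradient expresses the change of the mean as a time integral
of g paired with that field. On a ball moving with velocity v and growing at rate σ the field is at
most |v| + |σ| (`HasWeakGradient.abs_mollifiedMean_sub_le`). No smooth approximation of u is needed.

Shrinking the ball to a Lebesgue point x bounds u(x) minus the mean by a Riesz potential
(`HasWeakGradient.abs_sub_mollifiedMean_le`). Integrated over B, the same bound shows that u is
integrable there and compares the mean with u_B.

Let δ(p) be the distance of p to the boundary. Passing between neighbouring balls B(p, δ(p)) costs a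
multiple of δ^(1-n) ∫ |g|. The John curve of x is covered by finitely many such balls with bounded
overlap, and connectedness, not an ordering of the balls, adds up the costs
(`IsPreconnected.abs_sub_le_two_mul_sum`).

The exponent s(x) enters through one comparison: if y lies in B(γ(t), δ/2), then |x - y| ≤ t + δ/2,
and the John condition gives |x - y|^s(x) ≤ C δ, hence δ^(1-n) ≤ C' |x - y|^(-s(x)(n-1))
(`rpow_le_of_john`). Since D is bounded and 1 ≤ s(x) ≤ S, the Riesz kernel and the constant 1 are
dominated by the same kernel. The triangle inequality then combines the three estimates. -/

section Mollifier

/-! ### Smooth kernels on moving balls and their continuity equation. -/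

variable {n : ℕ}

/-- A smooth bump function centred at the origin and supported in the closed unit ball. -/
noncomputable def unitBump (n : ℕ) : ContDiffBump (0 : EuclideanSpace ℝ (Fin n)) where
  rIn := 1 / 2
  rOut := 1
  rIn_pos := by norm_num
  rIn_lt_rOut := by norm_num

/-- A smooth probability density supported in the closed unit ball. -/
noncomputable def mollifier (n : ℕ) : EuclideanSpace ℝ (Fin n) → ℝ :=
  (unitBump n).normed volume

lemma contDiff_mollifier : ContDiff ℝ ∞ (mollifier n) :=
  (unitBump n).contDiff_normed (n := ⊤)

lemma mollifier_nonneg (y : EuclideanSpace ℝ (Fin n)) : 0 ≤ mollifier n y :=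
  (unitBump n).nonneg_normed y

lemma mollifier_eq_zero {y : EuclideanSpace ℝ (Fin n)} (hy : 1 ≤ ‖y‖) : mollifier n y = 0 := by
  rw [← Function.notMem_support, mollifier, ContDiffBump.support_normed_eq]
  simpa [unitBump] using hy

lemma integral_mollifier : ∫ y, mollifier n y = 1 := (unitBump n).integral_normed

/-- An upper bound of `mollifier n`. -/
noncomputable def mollifierBound (n : ℕ) : ℝ :=
  1 / volume.real (Metric.closedBall (0 : EuclideanSpace ℝ (Fin n)) (1 / 2))

lemma mollifierBound_pos : 0 < mollifierBound n := by
  refine one_div_pos.2 (ENNReal.toReal_pos ?_ measure_closedBall_lt_top.ne)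
  exact (Metric.measure_closedBall_pos _ _ (by norm_num)).ne'

lemma mollifier_le (y : EuclideanSpace ℝ (Fin n)) : mollifier n y ≤ mollifierBound n :=
  (unitBump n).normed_le_div_measure_closedBall_rIn volume y

/-- The mollifier rescaled to the ball with centre `c` and radius `r`. -/
noncomputable def scaledMollifier (c : EuclideanSpace ℝ (Fin n)) (r : ℝ)
    (y : EuclideanSpace ℝ (Fin n)) : ℝ :=
  r⁻¹ ^ n * mollifier n (r⁻¹ • (y - c))

lemma contDiff_scaledMollifier (c : EuclideanSpace ℝ (Fin n)) (r : ℝ) :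
    ContDiff ℝ ∞ (scaledMollifier c r) :=
  contDiff_const.mul (contDiff_mollifier.comp (by fun_prop))

lemma scaledMollifier_nonneg (c : EuclideanSpace ℝ (Fin n)) {r : ℝ} (hr : 0 < r)
    (y : EuclideanSpace ℝ (Fin n)) : 0 ≤ scaledMollifier c r y :=
  mul_nonneg (by positivity) (mollifier_nonneg _)

lemma scaledMollifier_le (c : EuclideanSpace ℝ (Fin n)) {r : ℝ} (hr : 0 < r)
    (y : EuclideanSpace ℝ (Fin n)) : scaledMollifier c r y ≤ r⁻¹ ^ n * mollifierBound n :=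
  mul_le_mul_of_nonneg_left (mollifier_le _) (by positivity)

lemma one_le_norm_inv_smul_sub {c y : EuclideanSpace ℝ (Fin n)} {r : ℝ} (hr : 0 < r)
    (hy : r ≤ dist y c) : 1 ≤ ‖r⁻¹ • (y - c)‖ := by
  rw [norm_smul, Real.norm_of_nonneg (by positivity), ← dist_eq_norm, inv_mul_eq_div]
  exact (one_le_div hr).2 hy

lemma scaledMollifier_eq_zero {c y : EuclideanSpace ℝ (Fin n)} {r : ℝ} (hr : 0 < r)
    (hy : r ≤ dist y c) : scaledMollifier c r y = 0 := by
  rw [scaledMollifier, mollifier_eq_zero (one_le_norm_inv_smul_sub hr hy), mul_zero]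

lemma support_scaledMollifier_subset (c : EuclideanSpace ℝ (Fin n)) {r : ℝ} (hr : 0 < r) :
    Function.support (scaledMollifier c r) ⊆ Metric.closedBall c r := by
  intro y hy
  by_contra h
  exact hy (scaledMollifier_eq_zero hr (by simpa using (not_le.1 h).le))

lemma tsupport_scaledMollifier_subset (c : EuclideanSpace ℝ (Fin n)) {r : ℝ} (hr : 0 < r) :
    tsupport (scaledMollifier c r) ⊆ Metric.closedBall c r :=
  closure_minimal (support_scaledMollifier_subset c hr) Metric.isClosed_closedBall

lemma hasCompactSupport_scaledMollifier (c : EuclideanSpace ℝ (Fin n)) {r : ℝ} (hr : 0 < r) :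
    HasCompactSupport (scaledMollifier c r) :=
  HasCompactSupport.of_support_subset_isCompact (isCompact_closedBall c r)
    (support_scaledMollifier_subset c hr)

lemma integral_scaledMollifier (c : EuclideanSpace ℝ (Fin n)) {r : ℝ} (hr : 0 < r) :
    ∫ y, scaledMollifier c r y = 1 := by
  have h := integral_sub_right_eq_self (μ := volume)
    (fun y : EuclideanSpace ℝ (Fin n) => r⁻¹ ^ n * mollifier n (r⁻¹ • y)) c
  simp only [scaledMollifier]
  rw [h, integral_const_mul, Measure.integral_comp_inv_smul_of_nonneg _ _ hr.le,
    integral_mollifier]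
  simp [hr.ne']

lemma fderiv_scaledMollifier (c : EuclideanSpace ℝ (Fin n)) (r : ℝ)
    (y w : EuclideanSpace ℝ (Fin n)) :
    fderiv ℝ (scaledMollifier c r) y w =
      r⁻¹ ^ n * fderiv ℝ (mollifier n) (r⁻¹ • (y - c)) (r⁻¹ • w) := by
  have h1 : HasFDerivAt (fun y : EuclideanSpace ℝ (Fin n) => r⁻¹ • (y - c))
      (r⁻¹ • ContinuousLinearMap.id ℝ _) y := ((hasFDerivAt_id y).sub_const c).const_smul r⁻¹
  have h2 := ((contDiff_mollifier (n := n)).differentiable (by simp)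
    (r⁻¹ • (y - c))).hasFDerivAt
  have h3 := (h2.comp y h1).const_mul (r⁻¹ ^ n)
  have h4 : HasFDerivAt (scaledMollifier c r) _ y := h3
  rw [h4.fderiv]
  simp

/-- The continuity equation for the mollifier whose centre moves with velocity `v` and whose
radius grows with speed `σ`. -/
lemma hasDerivAt_scaledMollifier (c v y : EuclideanSpace ℝ (Fin n)) (r σ t : ℝ)
    (h : r + t * σ ≠ 0) :
    HasDerivAt (fun τ : ℝ => scaledMollifier (c + τ • v) (r + τ * σ) y)
      (-(n * (σ * (r + t * σ)⁻¹) * scaledMollifier (c + t • v) (r + t * σ) y +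
        fderiv ℝ (scaledMollifier (c + t • v) (r + t * σ)) y
          (v + (σ * (r + t * σ)⁻¹) • (y - (c + t • v))))) t := by
  have hr : HasDerivAt (fun τ : ℝ => r + τ * σ) σ t := by
    simpa using ((hasDerivAt_id t).mul_const σ).const_add r
  have hi := hr.inv h
  have hp := hi.pow n
  have hc : HasDerivAt (fun τ : ℝ => y - (c + τ • v)) (-v) t := by
    simpa using (((hasDerivAt_id t).smul_const v).const_add c).const_sub y
  have hz := hi.smul hc
  have hm := (((contDiff_mollifier (n := n)).differentiable (by simp)
    ((r + t * σ)⁻¹ • (y - (c + t • v)))).hasFDerivAt).comp_hasDerivAt t hz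
  have := hp.mul hm
  refine this.congr_deriv ?_
  rw [fderiv_scaledMollifier, scaledMollifier]
  set ρ := r + t * σ
  set z := y - (c + t • v)
  have e : ρ⁻¹ • (-v) + (-σ / ρ ^ 2) • z = -(ρ⁻¹ • (v + (σ * ρ⁻¹) • z)) := by
    rw [smul_add, neg_add, smul_neg, smul_smul, ← neg_smul (ρ⁻¹ * _)]
    congr 2
    field_simp
  change n * ρ⁻¹ ^ (n - 1) * (-σ / ρ ^ 2) * mollifier n (ρ⁻¹ • z) +
    ρ⁻¹ ^ n * fderiv ℝ (mollifier n) (ρ⁻¹ • z) (ρ⁻¹ • (-v) + (-σ / ρ ^ 2) • z) = _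
  rw [e, map_neg]
  generalize fderiv ℝ (mollifier n) (ρ⁻¹ • z) _ = A
  generalize mollifier n (ρ⁻¹ • z) = B
  clear_value ρ
  -- The power rule produces the truncated exponent n - 1, so dimension 0 is separated.
  rcases n with _ | m
  · simp
  · simp only [Nat.add_sub_cancel]
    push_cast
    rw [inv_pow, inv_pow, pow_succ]
    field_simp
    ring

end Mollifier

/-! ### Weak gradients tested against affine vector fields. -/

section WeakGradient

variable {n : ℕ} {D : Set (EuclideanSpace ℝ (Fin n))} {u : EuclideanSpace ℝ (Fin n) → ℝ}
  {g : EuclideanSpace ℝ (Fin n) → EuclideanSpace ℝ (Fin n)}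

lemma MeasureTheory.LocallyIntegrableOn.integrableOn_mul_of_support_subset
    (hu : LocallyIntegrableOn u D) {Q : Set (EuclideanSpace ℝ (Fin n))} (hQ : IsCompact Q)
    (hQD : Q ⊆ D) {f : EuclideanSpace ℝ (Fin n) → ℝ} (hf : Continuous f)
    (hfQ : Function.support f ⊆ Q) : IntegrableOn (fun x => u x * f x) D := by
  have h1 : IntegrableOn (fun x => u x * f x) Q :=
    (hu.integrableOn_compact_subset hQD hQ).mul_continuousOn hf.continuousOn hQ
  refine ((integrableOn_iff_integrable_of_support_subset ?_).1 h1).integrableOn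
  intro x hx
  exact hfQ (right_ne_zero_of_mul hx)

/-- The weak gradient tested against the vector field `x ↦ (v + b • (x - c)) * φ x`. -/
lemma HasWeakGradient.integral_affine_field (h : HasWeakGradient D u g)
    {φ : EuclideanSpace ℝ (Fin n) → ℝ} (hφ : ContDiff ℝ ∞ φ) (hc : HasCompactSupport φ)
    (hD : tsupport φ ⊆ D) (v c : EuclideanSpace ℝ (Fin n)) (b : ℝ) :
    ∫ x in D, u x * (n * b * φ x + fderiv ℝ φ x (v + b • (x - c))) =
      -∫ x in D, inner ℝ (g x) (v + b • (x - c)) * φ x := by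
  have hdφ : ∀ w : EuclideanSpace ℝ (Fin n), Continuous fun x => fderiv ℝ φ x w := fun w =>
    (hφ.continuous_fderiv (by simp)).clm_apply continuous_const
  let e : Fin n → EuclideanSpace ℝ (Fin n) := fun i => EuclideanSpace.single i 1
  -- Only scalar test functions with a constant direction are available: the i-th component of the
  -- field is tested in direction `e i` and the identities are summed. The divergence of the affine
  -- factor is n b.
  let ψ : Fin n → EuclideanSpace ℝ (Fin n) → ℝ := fun i x => (v + b • (x - c)) i * φ x
  have hψ : ∀ i, ContDiff ℝ ∞ (ψ i) := fun i => by
    refine ContDiff.mul ?_ hφ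
    have : (fun x : EuclideanSpace ℝ (Fin n) => (v + b • (x - c)) i) =
        fun x => EuclideanSpace.proj (𝕜 := ℝ) i (v + b • (x - c)) := rfl
    rw [this]
    fun_prop
  have hsupp : ∀ i, Function.support (ψ i) ⊆ Function.support φ := fun i x hx =>
    right_ne_zero_of_mul hx
  have hts : ∀ i, tsupport (ψ i) ⊆ tsupport φ := fun i => closure_mono (hsupp i)
  have hcψ : ∀ i, HasCompactSupport (ψ i) := fun i =>
    hc.of_isClosed_subset (isClosed_tsupport _) (hts i)
  have key : ∀ i, ∫ x in D, u x * fderiv ℝ (ψ i) x (e i) =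
      -∫ x in D, inner ℝ (g x) (e i) * ψ i x := fun i =>
    h.integral_eq _ (hψ i) (hcψ i) ((hts i).trans hD) _
  have hd : ∀ i x, fderiv ℝ (ψ i) x (e i) =
      b * φ x + (v + b • (x - c)) i * fderiv ℝ φ x (e i) := by
    intro i x
    have h1 : HasFDerivAt (fun x : EuclideanSpace ℝ (Fin n) => (v + b • (x - c)) i)
        (EuclideanSpace.proj (𝕜 := ℝ) i ∘L (b • ContinuousLinearMap.id ℝ _)) x :=
      (EuclideanSpace.proj (𝕜 := ℝ) i).hasFDerivAt.comp x
        ((((hasFDerivAt_id x).sub_const c).const_smul b).const_add v)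
    have h2 := (hφ.differentiable (by simp) x).hasFDerivAt
    have h3 : HasFDerivAt (ψ i) _ x := h1.mul h2
    rw [h3.fderiv]
    simp [e]
    ring
  have hi1 : ∀ i ∈ Finset.univ, IntegrableOn (fun x => u x * fderiv ℝ (ψ i) x (e i)) D := by
    intro i _
    refine h.locallyIntegrable.integrableOn_mul_of_support_subset (hcψ i) ((hts i).trans hD)
      (((hψ i).continuous_fderiv (by simp)).clm_apply continuous_const) ?_
    intro x hx
    refine support_fderiv_subset ℝ (f := ψ i) (fun h0 => hx ?_)
    simp [h0]
  have hi2 : ∀ i ∈ Finset.univ, IntegrableOn (fun x => inner ℝ (g x) (e i) * ψ i x) D := by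
    intro i _
    have hl : LocallyIntegrableOn (fun x => inner ℝ (g x) (e i)) D := by
      intro x hx
      obtain ⟨s, hs, hgs⟩ := h.locallyIntegrable_grad x hx
      exact ⟨s, hs, Integrable.inner_const hgs (e i)⟩
    exact hl.integrableOn_mul_of_support_subset (hcψ i) ((hts i).trans hD) (hψ i).continuous
      (subset_tsupport _)
  calc ∫ x in D, u x * (n * b * φ x + fderiv ℝ φ x (v + b • (x - c)))
      = ∫ x in D, ∑ i, u x * fderiv ℝ (ψ i) x (e i) := by
        congr 1 with x
        simp_rw [hd, mul_add, Finset.sum_add_distrib, ← mul_assoc]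
        congr 1
        · simp
          ring
        · have : (v + b • (x - c)) = ∑ i, (v + b • (x - c)) i • e i := by
            simpa [e] using ((EuclideanSpace.basisFun (Fin n) ℝ).sum_repr
              (v + b • (x - c))).symm
          conv_lhs => rw [this]
          rw [map_sum, Finset.mul_sum]
          simp [mul_assoc]
    _ = -∫ x in D, ∑ i, inner ℝ (g x) (e i) * ψ i x := by
        rw [integral_finsetSum _ hi1, integral_finsetSum _ hi2, ← Finset.sum_neg_distrib]
        exact Finset.sum_congr rfl fun i _ => key i
    _ = _ := by
        congr 2 with x
        simp only [ψ, e, ← mul_assoc, ← Finset.sum_mul]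
        congr 1
        rw [PiLp.inner_apply]
        refine Finset.sum_congr rfl fun i _ => ?_
        simp [EuclideanSpace.inner_single_right, mul_comm]

end WeakGradient

/-! ### Change of a mean when its ball moves. -/

section MollifiedMean

variable {n : ℕ} {D : Set (EuclideanSpace ℝ (Fin n))} {u : EuclideanSpace ℝ (Fin n) → ℝ}
  {g : EuclideanSpace ℝ (Fin n) → EuclideanSpace ℝ (Fin n)}

/-- The weighted mean of `u` over the ball with centre `c` and radius `r`. -/
noncomputable def mollifiedMean (D : Set (EuclideanSpace ℝ (Fin n)))
    (u : EuclideanSpace ℝ (Fin n) → ℝ) (c : EuclideanSpace ℝ (Fin n)) (r : ℝ) : ℝ :=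
  ∫ y in D, u y * scaledMollifier c r y

/-- Minus the velocity of the mollifier whose centre moves with velocity `v` and whose radius
grows with speed `σ`. -/
noncomputable def mollifierFlux (v : EuclideanSpace ℝ (Fin n)) (σ : ℝ)
    (c : EuclideanSpace ℝ (Fin n)) (r : ℝ) (y : EuclideanSpace ℝ (Fin n)) : ℝ :=
  n * (σ * r⁻¹) * scaledMollifier c r y +
    fderiv ℝ (scaledMollifier c r) y (v + (σ * r⁻¹) • (y - c))

lemma mollifierFlux_eq_zero (v : EuclideanSpace ℝ (Fin n)) (σ : ℝ)
    {c y : EuclideanSpace ℝ (Fin n)} {r : ℝ} (hr : 0 < r) (hy : y ∉ Metric.closedBall c r) :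
    mollifierFlux v σ c r y = 0 := by
  have h1 : y ∉ tsupport (scaledMollifier c r) := fun h =>
    hy (tsupport_scaledMollifier_subset c hr h)
  have h2 : fderiv ℝ (scaledMollifier c r) y = 0 := by
    by_contra h
    exact h1 (support_fderiv_subset ℝ h)
  rw [mollifierFlux, image_eq_zero_of_notMem_tsupport h1, h2]
  simp

lemma continuousOn_mollifierFlux (c v : EuclideanSpace ℝ (Fin n)) (r σ : ℝ) {I : Set ℝ}
    (hr : ∀ t ∈ I, 0 < r + t * σ) (Q : Set (EuclideanSpace ℝ (Fin n))) :
    ContinuousOn (fun p : ℝ × EuclideanSpace ℝ (Fin n) =>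
      mollifierFlux v σ (c + p.1 • v) (r + p.1 * σ) p.2) (I ×ˢ Q) := by
  have hi : ContinuousOn (fun p : ℝ × EuclideanSpace ℝ (Fin n) => (r + p.1 * σ)⁻¹) (I ×ˢ Q) :=
    ContinuousOn.inv₀ (by fun_prop) fun p hp => (hr p.1 hp.1).ne'
  have hm : Continuous (mollifier n) := contDiff_mollifier.continuous
  have hm' : Continuous (fderiv ℝ (mollifier n)) := contDiff_mollifier.continuous_fderiv (by simp)
  have hz : ContinuousOn (fun p : ℝ × EuclideanSpace ℝ (Fin n) =>
      (r + p.1 * σ)⁻¹ • (p.2 - (c + p.1 • v))) (I ×ˢ Q) := hi.smul (by fun_prop)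
  simp only [mollifierFlux, fderiv_scaledMollifier]
  refine ContinuousOn.add (ContinuousOn.mul (by fun_prop)
    ((hi.pow n).mul (hm.comp_continuousOn hz))) ((hi.pow n).mul ?_)
  exact (hm'.comp_continuousOn hz).clm_apply (hi.smul (by fun_prop))

lemma setIntegral_mul_eq_of_support_subset {Q : Set (EuclideanSpace ℝ (Fin n))}
    (hD : MeasurableSet D) (hQD : Q ⊆ D) {f : EuclideanSpace ℝ (Fin n) → ℝ}
    (hf : Function.support f ⊆ Q) : ∫ y in D, u y * f y = ∫ y in Q, u y * f y := by
  refine setIntegral_eq_of_subset_of_forall_sdiff_eq_zero hD hQD fun y hy => ?_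
  rw [Function.notMem_support.1 fun hy' => hy.2 (hf hy'), mul_zero]

/-- Moving the centre and the radius of a mollified mean changes it by at most the integral of the
gradient over the balls passed through. -/
theorem HasWeakGradient.abs_mollifiedMean_sub_le (h : HasWeakGradient D u g)
    (hD : MeasurableSet D) {Q : Set (EuclideanSpace ℝ (Fin n))} (hQ : IsCompact Q) (hQD : Q ⊆ D)
    (c v : EuclideanSpace ℝ (Fin n)) (r σ : ℝ) {T : ℝ} (hT : 0 ≤ T)
    (hr : ∀ t ∈ Icc 0 T, 0 < r + t * σ)
    (hball : ∀ t ∈ Icc 0 T, Metric.closedBall (c + t • v) (r + t * σ) ⊆ Q) :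
    ENNReal.ofReal |mollifiedMean D u (c + T • v) (r + T * σ) - mollifiedMean D u c r| ≤
      ∫⁻ t in Icc 0 T, ∫⁻ y in D, ‖g y‖ₑ *
        ENNReal.ofReal ((‖v‖ + |σ|) * scaledMollifier (c + t • v) (r + t * σ) y) := by
  have huQ : IntegrableOn u Q := h.locallyIntegrable.integrableOn_compact_subset hQD hQ
  set Φ : ℝ → EuclideanSpace ℝ (Fin n) → ℝ := fun t y =>
    mollifierFlux v σ (c + t • v) (r + t * σ) y with hΦ
  have hcont : ContinuousOn (Function.uncurry Φ) (Icc 0 T ×ˢ Q) :=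
    continuousOn_mollifierFlux c v r σ hr Q
  -- Fubini is the reason for the compact set Q: u is integrable on it and Φ is bounded on [0, T] ×
  -- Q.
  have hint : Integrable (Function.uncurry fun y t => u y * Φ t y)
      ((volume.restrict Q).prod (volume.restrict (Icc 0 T))) := by
    obtain ⟨C, hC⟩ := (isCompact_Icc.prod hQ).exists_bound_of_continuousOn hcont
    have hb : Integrable (fun p : EuclideanSpace ℝ (Fin n) × ℝ => u p.1 * 1)
        ((volume.restrict Q).prod (volume.restrict (Icc 0 T))) :=
      Integrable.mul_prod (f := u) (g := fun _ : ℝ => (1 : ℝ)) huQ (integrable_const 1)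
    have hm : MeasurableSet (Q ×ˢ Icc 0 T) := hQ.measurableSet.prod measurableSet_Icc
    simp only [mul_one] at hb
    rw [Measure.prod_restrict] at hb ⊢
    have hΦm : AEStronglyMeasurable (fun p : EuclideanSpace ℝ (Fin n) × ℝ => Φ p.2 p.1)
        ((volume.prod volume).restrict (Q ×ˢ Icc 0 T)) :=
      (hcont.comp (f := Prod.swap) continuous_swap.continuousOn
        fun p hp => ⟨hp.2, hp.1⟩).aestronglyMeasurable hm
    have hΦb : ∀ᵐ p ∂((volume.prod volume).restrict (Q ×ˢ Icc 0 T)), ‖Φ p.2 p.1‖ ≤ C := by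
      filter_upwards [ae_restrict_mem hm] with p hp using hC (p.2, p.1) ⟨hp.2, hp.1⟩
    exact Integrable.mul_bdd (f := fun p : EuclideanSpace ℝ (Fin n) × ℝ => u p.1) hb hΦm hΦb
  have hmean : ∀ t ∈ Icc 0 T, mollifiedMean D u (c + t • v) (r + t * σ) =
      ∫ y in Q, u y * scaledMollifier (c + t • v) (r + t * σ) y := fun t ht =>
    setIntegral_mul_eq_of_support_subset hD hQD
      ((support_scaledMollifier_subset _ (hr t ht)).trans (hball t ht))
  have hmi : ∀ t ∈ Icc 0 T,
      IntegrableOn (fun y => u y * scaledMollifier (c + t • v) (r + t * σ) y) Q := fun t _ =>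
    huQ.mul_continuousOn (contDiff_scaledMollifier _ _).continuous.continuousOn hQ
  have h0T : (0 : ℝ) ∈ Icc 0 T := ⟨le_rfl, hT⟩
  have hTT : T ∈ Icc 0 T := ⟨hT, le_rfl⟩
  have h0 := hmean 0 h0T
  have hi0 := hmi 0 h0T
  simp only [zero_smul, zero_mul, add_zero] at h0 hi0
  have hftc : ∀ y ∈ Q, scaledMollifier (c + T • v) (r + T * σ) y - scaledMollifier c r y =
      -∫ t in Icc 0 T, Φ t y := by
    intro y hy
    have hcy : ContinuousOn (fun t => Φ t y) (Icc 0 T) :=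
      hcont.comp (f := fun t => (t, y)) (by fun_prop) fun t ht => ⟨ht, hy⟩
    have := intervalIntegral.integral_eq_sub_of_hasDerivAt (a := 0) (b := T)
      (f := fun t : ℝ => scaledMollifier (c + t • v) (r + t * σ) y) (f' := fun t => -Φ t y)
      (fun t ht => hasDerivAt_scaledMollifier c v y r σ t
        (hr t (by rwa [uIcc_of_le hT] at ht)).ne')
      (ContinuousOn.intervalIntegrable (by rw [uIcc_of_le hT]; exact hcy.neg))
    rw [integral_Icc_eq_integral_Ioc, ← intervalIntegral.integral_of_le hT,
      ← intervalIntegral.integral_neg, this]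
    simp
  have hdiff : mollifiedMean D u (c + T • v) (r + T * σ) - mollifiedMean D u c r =
      ∫ t in Icc 0 T, ∫ y in D, inner ℝ (g y) (v + (σ * (r + t * σ)⁻¹) • (y - (c + t • v))) *
        scaledMollifier (c + t • v) (r + t * σ) y := by
    rw [hmean T hTT, h0, ← integral_sub (hmi T hTT) hi0]
    calc _ = ∫ y in Q, -∫ t in Icc 0 T, u y * Φ t y := by
          refine setIntegral_congr_fun hQ.measurableSet fun y hy => ?_
          beta_reduce
          rw [← mul_sub, hftc y hy, integral_const_mul, mul_neg]
      _ = -∫ t in Icc 0 T, ∫ y in Q, u y * Φ t y := by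
          rw [integral_neg, integral_integral_swap hint]
      _ = _ := by
          rw [← integral_neg]
          refine setIntegral_congr_fun measurableSet_Icc fun t ht => ?_
          beta_reduce
          rw [← setIntegral_mul_eq_of_support_subset hD hQD, hΦ]
          · simp only [mollifierFlux]
            rw [h.integral_affine_field (contDiff_scaledMollifier _ _)
              (hasCompactSupport_scaledMollifier _ (hr t ht))
              ((tsupport_scaledMollifier_subset _ (hr t ht)).trans ((hball t ht).trans hQD)),
              neg_neg]
          · intro y hy
            by_contra hyQ
            exact hy (mollifierFlux_eq_zero v σ (hr t ht) fun hb => hyQ (hball t ht hb))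
  rw [hdiff, ← Real.enorm_eq_ofReal_abs]
  refine (enorm_integral_le_lintegral_enorm _).trans (setLIntegral_mono' measurableSet_Icc ?_)
  intro t ht
  refine (enorm_integral_le_lintegral_enorm _).trans (lintegral_mono fun y => ?_)
  have hk := scaledMollifier_nonneg (c + t • v) (hr t ht) y
  rw [enorm_mul, Real.enorm_eq_ofReal hk, ENNReal.ofReal_mul (by positivity), ← mul_assoc]
  -- Inside the ball |y - centre| is less than the radius, so the field v + (σ / radius)(y - centre)
  -- has norm at most |v| + |σ|; outside, the kernel vanishes.
  by_cases hy : dist y (c + t • v) < r + t * σ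
  · gcongr
    rw [← ofReal_norm, ← ofReal_norm, ← ENNReal.ofReal_mul (by positivity)]
    refine ENNReal.ofReal_le_ofReal ((norm_inner_le_norm _ _).trans ?_)
    gcongr
    refine (norm_add_le _ _).trans ?_
    gcongr
    rw [norm_smul, norm_mul, norm_inv, Real.norm_eq_abs, Real.norm_eq_abs, abs_of_pos (hr t ht),
      ← dist_eq_norm, mul_assoc, inv_mul_eq_div]
    exact mul_le_of_le_one_right (abs_nonneg _) ((div_le_one (hr t ht)).2 hy.le)
  · rw [scaledMollifier_eq_zero (hr t ht) (not_lt.1 hy)]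
    simp

end MollifiedMean

/-! ### The kernel of a shrinking ball, and Lebesgue points. -/

section LocalEstimates

open Filter Topology

variable {n : ℕ} {D : Set (EuclideanSpace ℝ (Fin n))} {u : EuclideanSpace ℝ (Fin n) → ℝ}
  {g : EuclideanSpace ℝ (Fin n) → EuclideanSpace ℝ (Fin n)}

lemma lintegral_inv_one_sub_pow_le {n : ℕ} (hn : 2 ≤ n) {τ : ℝ} (hτ : τ < 1) :
    ∫⁻ t in Icc 0 τ, ENNReal.ofReal ((1 - t)⁻¹ ^ n) ≤ ENNReal.ofReal ((1 - τ)⁻¹ ^ (n - 1)) := by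
  obtain ⟨m, rfl⟩ := Nat.exists_eq_add_of_le' hn
  -- A negative τ does occur below: it means that y is too far from x to meet any of the moving
  -- balls.
  rcases lt_or_ge τ 0 with h0 | h0
  · simp [Icc_eq_empty h0.not_ge]
  have hne : ∀ t ∈ Icc 0 τ, 1 - t ≠ 0 := fun t ht => by linarith [ht.2]
  have hc : ContinuousOn (fun t : ℝ => (1 - t)⁻¹ ^ (m + 2)) (Icc 0 τ) :=
    (ContinuousOn.inv₀ (by fun_prop) hne).pow _
  rw [← ofReal_integral_eq_lintegral_ofReal (hc.integrableOn_compact isCompact_Icc)]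
  · refine ENNReal.ofReal_le_ofReal ?_
    rw [integral_Icc_eq_integral_Ioc, ← intervalIntegral.integral_of_le h0]
    rw [intervalIntegral.integral_eq_sub_of_hasDerivAt
      (f := fun t : ℝ => (1 - t)⁻¹ ^ (m + 1) / (m + 1))]
    · have h1 : 0 ≤ (1 - τ)⁻¹ ^ (m + 1) := by
        have : 0 < 1 - τ := by linarith
        positivity
      have h2 : (1 - τ)⁻¹ ^ (m + 1) / (m + 1 : ℝ) ≤ (1 - τ)⁻¹ ^ (m + 1) :=
        div_le_self h1 (by linarith [(Nat.cast_nonneg m : (0 : ℝ) ≤ m)])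
      have h3 : (0 : ℝ) ≤ (1 - 0)⁻¹ ^ (m + 1) / (m + 1) := by positivity
      show _ ≤ (1 - τ)⁻¹ ^ (m + 1)
      linarith
    · intro t ht
      rw [uIcc_of_le h0] at ht
      have hd : HasDerivAt (fun t : ℝ => 1 - t) (-1) t := by
        simpa using (hasDerivAt_id t).const_sub 1
      have := ((hd.inv (hne t ht)).pow (m + 1)).div_const ((m : ℝ) + 1)
      refine this.congr_deriv ?_
      have := hne t ht
      have hm : (m : ℝ) + 1 ≠ 0 := by positivity
      simp only [Pi.inv_apply, Nat.add_sub_cancel]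
      push_cast
      rw [inv_pow, inv_pow]
      field_simp
      ring
    · exact ContinuousOn.intervalIntegrable (by rwa [uIcc_of_le h0])
  · filter_upwards [ae_restrict_mem measurableSet_Icc] with t ht
    have : 0 ≤ 1 - t := by linarith [ht.2]
    positivity

lemma measurable_scaledMollifier_path (c v : EuclideanSpace ℝ (Fin n)) (r σ : ℝ) :
    Measurable fun p : ℝ × EuclideanSpace ℝ (Fin n) =>
      scaledMollifier (c + p.1 • v) (r + p.1 * σ) p.2 := by
  have hm : Measurable (mollifier n) := contDiff_mollifier.continuous.measurable
  have hi : Measurable fun p : ℝ × EuclideanSpace ℝ (Fin n) => (r + p.1 * σ)⁻¹ := by fun_prop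
  exact (hi.pow_const n).mul (hm.comp (hi.smul (by fun_prop)))

/-- At time t the centre is at distance (1 - t)|x - z| from x and the radius is (1 - t) r / 4,
whence the factor 5/4. -/
lemma dist_le_of_mem_cone {x y z : EuclideanSpace ℝ (Fin n)} {r t : ℝ} (ht : t ≤ 1)
    (hx : dist x z ≤ r) (hy : dist y (z + t • (x - z)) ≤ r / 4 + t * (-(r / 4))) :
    dist x y ≤ 5 / 4 * r * (1 - t) := by
  have h1 : dist (z + t • (x - z)) x = (1 - t) * dist x z := by
    rw [dist_eq_norm, dist_eq_norm, show z + t • (x - z) - x = (t - 1) • (x - z) by module,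
      norm_smul, Real.norm_eq_abs, abs_of_nonpos (by linarith), neg_sub]
  have h2 := dist_triangle y (z + t • (x - z)) x
  rw [dist_comm x y]
  nlinarith

/-- A point y is met only while 1 - t ≥ 4|x - y| / (5r), that is up to the time `τ`, and the kernel
is at most a multiple of (r(1 - t))^(-n). Integrating in t gains one power, and all powers of r
cancel, leaving exactly 5^n. -/
lemma lintegral_cone_kernel_le (hn : 2 ≤ n) {x y z : EuclideanSpace ℝ (Fin n)} {r T : ℝ}
    (hr : 0 < r) (hx : dist x z ≤ r) (hxy : x ≠ y) (hT : T < 1) :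
    ∫⁻ t in Icc 0 T, ENNReal.ofReal ((‖x - z‖ + |-(r / 4)|) *
        scaledMollifier (z + t • (x - z)) (r / 4 + t * (-(r / 4))) y) ≤
      ENNReal.ofReal (5 ^ n * mollifierBound n * (dist x y)⁻¹ ^ (n - 1)) := by
  have hM := mollifierBound_pos (n := n)
  have hδ : 0 < dist x y := dist_pos.2 hxy
  set τ : ℝ := 1 - 4 / 5 * dist x y / r with hτ
  have hτ1 : τ < 1 := by rw [hτ]; linarith [show 0 < 4 / 5 * dist x y / r by positivity]
  have hbound : ∀ t ∈ Icc 0 T, ENNReal.ofReal ((‖x - z‖ + |-(r / 4)|) *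
      scaledMollifier (z + t • (x - z)) (r / 4 + t * (-(r / 4))) y) ≤
      (Icc 0 τ).indicator (fun t => ENNReal.ofReal (5 / 4 * r * (4 / r) ^ n * mollifierBound n) *
        ENNReal.ofReal ((1 - t)⁻¹ ^ n)) t := by
    intro t ht
    have ht1 : 0 < 1 - t := by linarith [ht.2]
    have hρ : 0 < r / 4 + t * (-(r / 4)) := by nlinarith
    by_cases hy : dist y (z + t • (x - z)) < r / 4 + t * (-(r / 4))
    · have hd := dist_le_of_mem_cone (by linarith) hx hy.le
      have htτ : t ∈ Icc 0 τ := by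
        refine ⟨ht.1, ?_⟩
        have : 4 / 5 * dist x y / r ≤ 1 - t := by
          rw [div_le_iff₀ hr]
          linarith
        linarith
      rw [indicator_of_mem htτ, ← ENNReal.ofReal_mul (by positivity)]
      refine ENNReal.ofReal_le_ofReal ?_
      have e : r / 4 + t * (-(r / 4)) = (4 / r)⁻¹ * (1 - t) := by field_simp; ring
      have h1 := scaledMollifier_le (z + t • (x - z)) hρ y
      have h0 := scaledMollifier_nonneg (z + t • (x - z)) hρ y
      have h2 : ‖x - z‖ + |-(r / 4)| ≤ 5 / 4 * r := by
        rw [← dist_eq_norm, abs_neg, abs_of_pos (by positivity)]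
        linarith
      calc _ ≤ 5 / 4 * r * ((r / 4 + t * (-(r / 4)))⁻¹ ^ n * mollifierBound n) := by gcongr
        _ = _ := by
          rw [e, mul_inv, inv_inv, mul_pow]
          ring
    · rw [scaledMollifier_eq_zero hρ (not_lt.1 hy)]
      simp
  calc _ ≤ ∫⁻ t in Icc 0 T, (Icc 0 τ).indicator (fun t => ENNReal.ofReal
          (5 / 4 * r * (4 / r) ^ n * mollifierBound n) * ENNReal.ofReal ((1 - t)⁻¹ ^ n)) t :=
        setLIntegral_mono' measurableSet_Icc hbound
    _ ≤ ∫⁻ t in Icc 0 τ, ENNReal.ofReal (5 / 4 * r * (4 / r) ^ n * mollifierBound n) *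
          ENNReal.ofReal ((1 - t)⁻¹ ^ n) := by
        refine (setLIntegral_le_lintegral _ _).trans ?_
        rw [lintegral_indicator measurableSet_Icc]
    _ ≤ ENNReal.ofReal (5 / 4 * r * (4 / r) ^ n * mollifierBound n) *
          ENNReal.ofReal ((1 - τ)⁻¹ ^ (n - 1)) := by
        rw [lintegral_const_mul' _ _ ENNReal.ofReal_ne_top]
        gcongr
        exact lintegral_inv_one_sub_pow_le hn hτ1
    _ = _ := by
        rw [← ENNReal.ofReal_mul (by positivity)]
        congr 1
        obtain ⟨m, rfl⟩ := Nat.exists_eq_add_of_le' hn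
        have e : 1 - τ = 4 / 5 * dist x y / r := by rw [hτ]; ring
        rw [e, show m + 2 - 1 = m + 1 from rfl]
        generalize mollifierBound (m + 2) = M
        rw [show (4 / 5 * dist x y / r)⁻¹ = 5 * (r / 4) * (dist x y)⁻¹ by field_simp, mul_pow,
          mul_pow]
        have e2 : (4 / r) ^ (m + 2) * (r / 4) ^ (m + 1) = 4 / r := by
          rw [pow_succ (4 / r) (m + 1), mul_right_comm, ← mul_pow]
          rw [show 4 / r * (r / 4) = 1 by field_simp]
          simp
        calc _ = 5 / 4 * r * ((4 / r) ^ (m + 2) * (r / 4) ^ (m + 1)) * M *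
              (5 ^ (m + 1) * (dist x y)⁻¹ ^ (m + 1)) := by ring
          _ = _ := by
            rw [e2]
            field_simp
            ring

/-- `x` is a Lebesgue point of `u` with respect to balls which need not be centred at `x`. -/
def IsLebesguePoint (u : EuclideanSpace ℝ (Fin n) → ℝ) (x : EuclideanSpace ℝ (Fin n)) : Prop :=
  ∀ (w : ℕ → EuclideanSpace ℝ (Fin n)) (δ : ℕ → ℝ), Tendsto δ atTop (𝓝[>] 0) →
    (∀ j, x ∈ Metric.closedBall (w j) (4 * δ j)) →
    Tendsto (fun j => ⨍ y in Metric.closedBall (w j) (δ j), ‖u y - u x‖) atTop (𝓝 0)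

/-- The differentiation theorem for doubling measures wants functions on the whole space, so it is
applied to the restrictions of u to countably many open sets exhausting D. The factor 4 suits the
cone: x is at most 4 radii away from the moving centre. -/
lemma MeasureTheory.LocallyIntegrableOn.ae_isLebesguePoint (hD : IsOpen D)
    (hu : LocallyIntegrableOn u D) : ∀ᵐ x ∂(volume.restrict D), IsLebesguePoint u x := by
  obtain ⟨U, hUo, hDU, hUi⟩ := hu.exists_nat_integrableOn
  rw [ae_restrict_iff' hD.measurableSet]
  have hall : ∀ k, ∀ᵐ x, _ := fun k =>
    IsUnifLocDoublingMeasure.ae_tendsto_average_norm_sub (volume)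
      ((integrable_indicator_iff ((hUo k).inter hD).measurableSet).2 (hUi k)).locallyIntegrable 4
  filter_upwards [ae_all_iff.2 hall] with x hx hxD w δ hδ hw
  obtain ⟨k, hk⟩ := mem_iUnion.1 (hDU hxD)
  have hlim := hx k w δ hδ (Eventually.of_forall hw)
  have hO : U k ∩ D ∈ 𝓝 x := ((hUo k).inter hD).mem_nhds ⟨hk, hxD⟩
  obtain ⟨ε, hε, hεs⟩ := Metric.mem_nhds_iff.1 hO
  have hδ0 : Tendsto δ atTop (𝓝 0) := hδ.mono_right nhdsWithin_le_nhds
  have hsmall : ∀ᶠ j in atTop, δ j < ε / 5 := hδ0.eventually_lt_const (by positivity)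
  refine hlim.congr' ?_
  filter_upwards [hsmall] with j hj
  refine setAverage_congr_fun measurableSet_closedBall (Eventually.of_forall fun y hy => ?_)
  have hyU : y ∈ U k ∩ D := by
    refine hεs ?_
    have h1 : dist y (w j) ≤ δ j := hy
    have h2 : dist x (w j) ≤ 4 * δ j := hw j
    rw [Metric.mem_ball]
    linarith [dist_triangle_right y x (w j)]
  rw [indicator_of_mem hyU, indicator_of_mem (show x ∈ U k ∩ D from ⟨hk, hxD⟩)]

/-- The kernel has mass one and is at most a multiple of δ^(-n), so the error is at most a constant
times the plain average of |u - u(x)|. -/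
lemma IsLebesguePoint.tendsto_mollifiedMean {x : EuclideanSpace ℝ (Fin n)}
    (hx : IsLebesguePoint u x) (hD : MeasurableSet D) (hu : LocallyIntegrableOn u D)
    {w : ℕ → EuclideanSpace ℝ (Fin n)}
    {δ : ℕ → ℝ} (hδ : Tendsto δ atTop (𝓝[>] 0)) (hδ0 : ∀ j, 0 < δ j)
    (hw : ∀ j, x ∈ Metric.closedBall (w j) (4 * δ j))
    (hwD : ∀ j, Metric.closedBall (w j) (δ j) ⊆ D) :
    Tendsto (fun j => mollifiedMean D u (w j) (δ j)) atTop (𝓝 (u x)) := by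
  set V := volume.real (Metric.ball (0 : EuclideanSpace ℝ (Fin n)) 1) with hV
  have hlim := (hx w δ hδ hw).const_mul (mollifierBound n * V)
  rw [mul_zero] at hlim
  refine tendsto_iff_norm_sub_tendsto_zero.2 (squeeze_zero (fun _ => norm_nonneg _) (fun j => ?_)
    hlim)
  set Q := Metric.closedBall (w j) (δ j)
  have huQ : IntegrableOn u Q :=
    hu.integrableOn_compact_subset (hwD j) (isCompact_closedBall _ _)
  have hkc : ContinuousOn (scaledMollifier (w j) (δ j)) Q :=
    (contDiff_scaledMollifier _ _).continuous.continuousOn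
  have h1 : mollifiedMean D u (w j) (δ j) = ∫ y in Q, u y * scaledMollifier (w j) (δ j) y :=
    setIntegral_mul_eq_of_support_subset hD (hwD j) (support_scaledMollifier_subset _ (hδ0 j))
  have h2 : ∫ y in Q, scaledMollifier (w j) (δ j) y = 1 := by
    rw [setIntegral_eq_integral_of_forall_compl_eq_zero, integral_scaledMollifier _ (hδ0 j)]
    intro y hy
    by_contra h
    exact hy (support_scaledMollifier_subset _ (hδ0 j) h)
  have h3 : mollifiedMean D u (w j) (δ j) - u x =
      ∫ y in Q, (u y - u x) * scaledMollifier (w j) (δ j) y := by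
    simp_rw [sub_mul]
    rw [integral_sub (huQ.mul_continuousOn hkc (isCompact_closedBall _ _))
      ((hkc.integrableOn_compact (isCompact_closedBall _ _)).const_mul _), integral_const_mul,
      h2, h1, mul_one]
  have hQf : IntegrableOn (fun y => ‖u y - u x‖) Q :=
    (huQ.sub (integrableOn_const measure_closedBall_lt_top.ne)).norm
  rw [h3, setAverage_eq]
  calc _ ≤ ∫ y in Q, ‖u y - u x‖ * ((δ j)⁻¹ ^ n * mollifierBound n) := by
        refine norm_integral_le_of_norm_le (hQf.mul_const _) (Eventually.of_forall fun y => ?_)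
        rw [norm_mul, Real.norm_of_nonneg (scaledMollifier_nonneg _ (hδ0 j) y)]
        gcongr
        exact scaledMollifier_le _ (hδ0 j) y
    _ = _ := by
        have hvol : volume.real Q = δ j ^ n * V := by
          have := Measure.addHaar_real_closedBall (volume : Measure (EuclideanSpace ℝ (Fin n)))
            (w j) (hδ0 j).le
          simpa [hV] using this
        have hVpos : 0 < V := ENNReal.toReal_pos
          (Metric.measure_ball_pos _ _ one_pos).ne' measure_ball_lt_top.ne
        have := hδ0 j
        rw [integral_mul_const, hvol, smul_eq_mul, inv_pow]
        field_simp

end LocalEstimates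

/-! ### Riesz bound in a ball, and comparison of neighbouring balls. -/

section LocalEstimates

open Filter Topology

variable {n : ℕ} {D : Set (EuclideanSpace ℝ (Fin n))} {u : EuclideanSpace ℝ (Fin n) → ℝ}
  {g : EuclideanSpace ℝ (Fin n) → EuclideanSpace ℝ (Fin n)}

lemma setLIntegral_le_of_le_indicator {X : Type*} [MeasurableSpace X] {μ : Measure X}
    {A B : Set X} (hB : MeasurableSet B) {f h : X → ℝ≥0∞}
    (hfh : ∀ᵐ x ∂μ.restrict A, f x ≤ B.indicator h x) :
    ∫⁻ x in A, f x ∂μ ≤ ∫⁻ x in B, h x ∂μ := by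
  refine (lintegral_mono_ae hfh).trans ((setLIntegral_le_lintegral _ _).trans ?_)
  rw [lintegral_indicator hB]

/-- In Lean the singular kernels take the value 0 at y = x, so kernel comparisons hold only off this
null point. -/
lemma ae_ne_of_two_le (hn : 2 ≤ n) (μ : Measure (EuclideanSpace ℝ (Fin n))) (hμ : μ ≪ volume)
    (x : EuclideanSpace ℝ (Fin n)) : ∀ᵐ y ∂μ, x ≠ y := by
  have : Nontrivial (Fin n) := Fin.nontrivial_iff_two_le.2 hn
  have : ∀ᵐ y ∂(volume : Measure (EuclideanSpace ℝ (Fin n))), x ≠ y := by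
    filter_upwards [compl_mem_ae_iff.2 (measure_singleton x)] with y hy h
    exact hy h.symm
  exact hμ.ae_le this

lemma HasWeakGradient.abs_mollifiedMean_cone_sub_le (hn : 2 ≤ n) (h : HasWeakGradient D u g)
    (hD : MeasurableSet D) {x z : EuclideanSpace ℝ (Fin n)} {r T : ℝ} (hr : 0 < r)
    (hball : Metric.ball z r ⊆ D) (hx : x ∈ Metric.ball z r) (hT0 : 0 ≤ T) (hT : T < 1) :
    ENNReal.ofReal |mollifiedMean D u (z + T • (x - z)) (r / 4 + T * (-(r / 4))) -
        mollifiedMean D u z (r / 4)| ≤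
      ∫⁻ y in Metric.ball z r, ‖g y‖ₑ *
        ENNReal.ofReal (5 ^ n * mollifierBound n * (dist x y)⁻¹ ^ (n - 1)) := by
  have hxz : dist x z < r := hx
  -- The moving balls stay in a closed ball of radius R < r, the compact set required by the
  -- moving-ball estimate even if the open ball touches the boundary of D.
  set R : ℝ := max (dist x z) (r / 4) with hR
  have hRr : R < r := max_lt hxz (by linarith)
  have hρ : ∀ t ∈ Icc 0 T, 0 < r / 4 + t * (-(r / 4)) := fun t ht => by
    nlinarith [ht.1, ht.2, mul_pos hr (show 0 < 1 - t by linarith [ht.2])]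
  have hsub : ∀ t ∈ Icc 0 T, Metric.closedBall (z + t • (x - z)) (r / 4 + t * (-(r / 4))) ⊆
      Metric.closedBall z R := by
    intro t ht
    refine Metric.closedBall_subset_closedBall' ?_
    have e : dist (z + t • (x - z)) z = t * dist x z := by
      rw [dist_eq_norm, dist_eq_norm, add_sub_cancel_left, norm_smul, Real.norm_of_nonneg ht.1]
    rw [e]
    have h1 : t * dist x z ≤ t * R := mul_le_mul_of_nonneg_left (le_max_left _ _) ht.1
    have h2 : (1 - t) * (r / 4) ≤ (1 - t) * R :=
      mul_le_mul_of_nonneg_left (le_max_right _ _) (by linarith [ht.2])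
    linarith
  refine (h.abs_mollifiedMean_sub_le hD (isCompact_closedBall z R)
    ((Metric.closedBall_subset_ball hRr).trans hball) z (x - z) (r / 4) (-(r / 4)) hT0 hρ
    hsub).trans ?_
  rw [lintegral_lintegral_swap]
  · refine setLIntegral_le_of_le_indicator measurableSet_ball ?_
    filter_upwards [ae_ne_of_two_le hn _ Measure.restrict_le_self.absolutelyContinuous x]
      with y hxy
    rw [lintegral_const_mul']
    · by_cases hy : y ∈ Metric.ball z r
      · rw [indicator_of_mem hy]
        gcongr
        exact lintegral_cone_kernel_le hn hr hxz.le hxy hT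
      · rw [indicator_of_notMem hy, nonpos_iff_eq_zero, mul_eq_zero]
        right
        rw [setLIntegral_congr_fun (g := fun _ => 0) measurableSet_Icc, lintegral_zero]
        intro t ht
        have : scaledMollifier (z + t • (x - z)) (r / 4 + t * (-(r / 4))) y = 0 := by
          by_contra h0
          exact hy (Metric.closedBall_subset_ball hRr
            (hsub t ht (support_scaledMollifier_subset _ (hρ t ht) h0)))
        simp only [this, mul_zero, ENNReal.ofReal_zero]
    · exact enorm_ne_top
  · have hg := h.locallyIntegrable_grad.aestronglyMeasurable.enorm
    have h1 := hg.comp_snd (μ := (volume : Measure ℝ).restrict (Icc 0 T))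
    refine AEMeasurable.mul h1 (Measurable.aemeasurable ?_)
    exact ((measurable_scaledMollifier_path z (x - z) (r / 4) (-(r / 4))).const_mul _).ennreal_ofReal

/-- The pointwise estimate of `u` by the Riesz potential of its gradient over a ball. -/
theorem HasWeakGradient.abs_sub_mollifiedMean_le (hn : 2 ≤ n) (h : HasWeakGradient D u g)
    (hD : MeasurableSet D) {x z : EuclideanSpace ℝ (Fin n)} {r : ℝ} (hr : 0 < r)
    (hball : Metric.ball z r ⊆ D) (hx : x ∈ Metric.ball z r) (hxL : IsLebesguePoint u x) :
    ENNReal.ofReal |u x - mollifiedMean D u z (r / 4)| ≤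
      ∫⁻ y in Metric.ball z r, ‖g y‖ₑ *
        ENNReal.ofReal (5 ^ n * mollifierBound n * (dist x y)⁻¹ ^ (n - 1)) := by
  have hxz : dist x z < r := hx
  -- The radius vanishes at time 1, so one stops at times tending to 1; the bound does not depend on
  -- j.
  let T : ℕ → ℝ := fun j => 1 - 1 / ((j : ℝ) + 1)
  have hj : ∀ j : ℕ, 0 < 1 / ((j : ℝ) + 1) := fun j => Nat.one_div_pos_of_nat
  have hT1 : ∀ j, T j < 1 := fun j => by simp only [T]; linarith [hj j]
  have hT0 : ∀ j, 0 ≤ T j := fun j => by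
    have : 1 / ((j : ℝ) + 1) ≤ 1 := by
      rw [div_le_one (by positivity)]
      linarith [(Nat.cast_nonneg j : (0 : ℝ) ≤ j)]
    simp only [T]
    linarith
  have hδe : ∀ j, r / 4 + T j * (-(r / 4)) = r / 4 * (1 / ((j : ℝ) + 1)) := fun j => by
    simp only [T]; ring
  have hδ0 : ∀ j, 0 < r / 4 + T j * (-(r / 4)) := fun j => by
    rw [hδe]; exact mul_pos (by positivity) (hj j)
  have hδ : Tendsto (fun j => r / 4 + T j * (-(r / 4))) atTop (𝓝[>] 0) := by
    refine tendsto_nhdsWithin_iff.2 ⟨?_, Eventually.of_forall hδ0⟩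
    simp_rw [hδe]
    simpa using (tendsto_one_div_add_atTop_nhds_zero_nat (𝕜 := ℝ)).const_mul (r / 4)
  have hlim : Tendsto (fun j => mollifiedMean D u (z + T j • (x - z)) (r / 4 + T j * (-(r / 4))))
      atTop (𝓝 (u x)) := by
    refine hxL.tendsto_mollifiedMean hD h.locallyIntegrable hδ hδ0 (fun j => ?_) (fun j => ?_)
    · rw [Metric.mem_closedBall, dist_eq_norm,
        show x - (z + T j • (x - z)) = (1 - T j) • (x - z) by module, norm_smul,
        Real.norm_of_nonneg (by linarith [hT1 j]), ← dist_eq_norm]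
      nlinarith [hT1 j]
    · refine Subset.trans (fun y hy => ?_) hball
      have e : dist (z + T j • (x - z)) z = T j * dist x z := by
        rw [dist_eq_norm, dist_eq_norm, add_sub_cancel_left, norm_smul,
          Real.norm_of_nonneg (hT0 j)]
      have h1 : dist y (z + T j • (x - z)) ≤ r / 4 + T j * (-(r / 4)) := hy
      have h2 := dist_triangle y (z + T j • (x - z)) z
      rw [Metric.mem_ball]
      nlinarith [hT1 j, hT0 j]
  refine le_of_tendsto ((ENNReal.continuous_ofReal.tendsto _).comp
    ((hlim.sub_const (mollifiedMean D u z (r / 4))).abs)) (Eventually.of_forall fun j => ?_)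
  exact h.abs_mollifiedMean_cone_sub_le hn hD hr hball hx (hT0 j) (hT1 j)

/-- Mollified means over neighbouring balls of comparable size. -/
theorem HasWeakGradient.abs_mollifiedMean_sub_le_of_dist_le (hn : 2 ≤ n)
    (h : HasWeakGradient D u g) (hD : MeasurableSet D) {p q : EuclideanSpace ℝ (Fin n)}
    {δ ε : ℝ} (hδ : 0 < δ) (hball : Metric.ball p δ ⊆ D) (hpq : dist q p ≤ δ / 20)
    (hε : |ε - δ| ≤ δ / 20) :
    ENNReal.ofReal |mollifiedMean D u q (ε / 4) - mollifiedMean D u p (δ / 4)| ≤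
      ENNReal.ofReal (5 ^ n * mollifierBound n * δ⁻¹ ^ (n - 1)) *
        ∫⁻ y in Metric.ball p (δ / 2), ‖g y‖ₑ := by
  have hM := mollifierBound_pos (n := n)
  obtain ⟨hε1, hε2⟩ := abs_le.1 hε
  -- Radii at least δ/5 bound the kernel by a multiple of (5/δ)^n; with speed at most δ this gives
  -- 5^n δ^(1-n).
  have hρ : ∀ t ∈ Icc (0 : ℝ) 1, δ / 5 ≤ δ / 4 + t * ((ε - δ) / 4) := fun t ht => by
    nlinarith [ht.1, ht.2]
  have hρ0 : ∀ t ∈ Icc (0 : ℝ) 1, 0 < δ / 4 + t * ((ε - δ) / 4) := fun t ht => by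
    linarith [hρ t ht]
  have hsub : ∀ t ∈ Icc (0 : ℝ) 1, Metric.closedBall (p + t • (q - p))
      (δ / 4 + t * ((ε - δ) / 4)) ⊆ Metric.closedBall p (δ / 3) := by
    intro t ht
    refine Metric.closedBall_subset_closedBall' ?_
    have e : dist (p + t • (q - p)) p = t * dist q p := by
      rw [dist_eq_norm, dist_eq_norm, add_sub_cancel_left, norm_smul, Real.norm_of_nonneg ht.1]
    rw [e]
    nlinarith [ht.1, ht.2, dist_nonneg (x := q) (y := p)]
  have key := h.abs_mollifiedMean_sub_le hD (isCompact_closedBall p (δ / 3))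
    ((Metric.closedBall_subset_ball (by linarith)).trans hball) p (q - p) (δ / 4) ((ε - δ) / 4)
    zero_le_one hρ0 hsub
  rw [one_smul, add_sub_cancel, show δ / 4 + 1 * ((ε - δ) / 4) = ε / 4 by ring] at key
  refine key.trans ?_
  calc _ ≤ ∫⁻ _ in Icc (0 : ℝ) 1, ENNReal.ofReal (5 ^ n * mollifierBound n * δ⁻¹ ^ (n - 1)) *
        ∫⁻ y in Metric.ball p (δ / 2), ‖g y‖ₑ := by
        refine setLIntegral_mono' measurableSet_Icc fun t ht => ?_
        rw [← lintegral_const_mul' _ _ ENNReal.ofReal_ne_top]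
        refine setLIntegral_le_of_le_indicator measurableSet_ball (Eventually.of_forall fun y => ?_)
        by_cases hy : y ∈ Metric.ball p (δ / 2)
        · rw [indicator_of_mem hy, mul_comm]
          gcongr ENNReal.ofReal ?_ * _
          have h1 := scaledMollifier_le (p + t • (q - p)) (hρ0 t ht) y
          have h0 := scaledMollifier_nonneg (p + t • (q - p)) (hρ0 t ht) y
          have h2 : ‖q - p‖ + |(ε - δ) / 4| ≤ δ := by
            rw [← dist_eq_norm, abs_div, abs_of_pos (by norm_num : (0 : ℝ) < 4)]
            linarith
          have h3 : (δ / 4 + t * ((ε - δ) / 4))⁻¹ ≤ (δ / 5)⁻¹ :=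
            inv_anti₀ (by positivity) (hρ t ht)
          have h4 := hρ0 t ht
          calc _ ≤ δ * ((δ / 5)⁻¹ ^ n * mollifierBound n) := by
                refine mul_le_mul h2 (h1.trans ?_) h0 hδ.le
                gcongr
            _ = _ := by
                obtain ⟨m, rfl⟩ := Nat.exists_eq_add_of_le' hn
                rw [show m + 2 - 1 = m + 1 from rfl, inv_div, div_eq_mul_inv, mul_pow,
                  pow_succ δ⁻¹ (m + 1)]
                field_simp
        · have : scaledMollifier (p + t • (q - p)) (δ / 4 + t * ((ε - δ) / 4)) y = 0 := by
            by_contra h0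
            exact hy (Metric.closedBall_subset_ball (by linarith)
              (hsub t ht (support_scaledMollifier_subset _ (hρ0 t ht) h0)))
          simp [this]
    _ = _ := by simp

end LocalEstimates

/-! ### Chaining along a continuum by connectedness and bounded overlap. -/

section Chain

open Filter Topology

/-- If a function on a preconnected set oscillates by at most `w i` around `b i` on the `i`-th set
of a finite open cover, then its total oscillation is at most `2 * ∑ i, w i`. -/
lemma IsPreconnected.abs_sub_le_two_mul_sum {X ι : Type*} [TopologicalSpace X] {K : Set X}
    (hK : IsPreconnected K) (P : Finset ι) (U : ι → Set X) (hU : ∀ i ∈ P, IsOpen (U i))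
    (hKU : K ⊆ ⋃ i ∈ P, U i) (a : X → ℝ) (b : ι → ℝ) (w : ι → ℝ≥0∞)
    (hw : ∀ i ∈ P, ∀ x ∈ K ∩ U i, ENNReal.ofReal |a x - b i| ≤ w i) {x y : X} (hx : x ∈ K)
    (hy : y ∈ K) : ENNReal.ofReal |a x - a y| ≤ 2 * ∑ i ∈ P, w i := by
  wlog hxy : a x ≤ a y generalizing x y
  · rw [abs_sub_comm]
    exact this hy hx (le_of_not_ge hxy)
  by_contra! hlt
  have hfin : ∀ i ∈ P, w i ≠ ⊤ := by
    intro i hi h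
    have : ∑ i ∈ P, w i = ⊤ := ENNReal.sum_eq_top.2 ⟨i, hi, h⟩
    rw [this] at hlt
    simp at hlt
  have hreal : ∀ i ∈ P, ∀ x ∈ K ∩ U i, |a x - b i| ≤ (w i).toReal := fun i hi x hx =>
    (ENNReal.ofReal_le_iff_le_toReal (hfin i hi)).1 (hw i hi x hx)
  -- The values of a on K lie in intervals of total length at most 2 ∑ w. If a(y) - a(x) were
  -- larger, some c strictly between would be missed by all of them.
  have hvol : volume (⋃ i ∈ P, Metric.closedBall (b i) (w i).toReal) < volume (Ioo (a x) (a y)) := by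
    refine lt_of_le_of_lt (measure_biUnion_finset_le _ _) (lt_of_le_of_lt (le_of_eq ?_)
      (hlt.trans_eq ?_))
    · rw [Finset.mul_sum]
      refine Finset.sum_congr rfl fun i hi => ?_
      rw [Real.volume_closedBall, ENNReal.ofReal_mul (by norm_num), ENNReal.ofReal_toReal (hfin i hi)]
      simp
    · rw [Real.volume_Ioo, abs_sub_comm, abs_of_nonneg (by linarith)]
  obtain ⟨c, hc, hcU⟩ : (Ioo (a x) (a y) \ ⋃ i ∈ P, Metric.closedBall (b i) (w i).toReal).Nonempty :=
    nonempty_of_measure_ne_zero (μ := volume) fun h0 =>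
      hvol.not_ge (measure_mono_ae (ae_le_set.2 h0))
  have hcout : ∀ i ∈ P, (w i).toReal < |c - b i| := by
    intro i hi
    by_contra! h
    exact hcU (mem_iUnion₂.2 ⟨i, hi, h⟩)
  have hside : ∀ i ∈ P, b i + (w i).toReal < c ∨ c < b i - (w i).toReal := by
    intro i hi
    rcases lt_abs.1 (hcout i hi) with h | h
    · left; linarith
    · right; linarith
  -- The cover splits into the sets whose interval lies below c and those whose interval lies above.
  -- Both unions are open and meet K, so they share a point of K, which is absurd; a itself need not
  -- be continuous.
  let V := ⋃ i ∈ P, ⋃ _ : b i + (w i).toReal < c, U i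
  let W := ⋃ i ∈ P, ⋃ _ : c < b i - (w i).toReal, U i
  have hV : ∀ z ∈ K, z ∈ V → a z < c := by
    intro z hz hzV
    simp only [V, mem_iUnion] at hzV
    obtain ⟨i, hi, hic, hzi⟩ := hzV
    linarith [(abs_le.1 (hreal i hi z ⟨hz, hzi⟩)).2]
  have hW : ∀ z ∈ K, z ∈ W → c < a z := by
    intro z hz hzW
    simp only [W, mem_iUnion] at hzW
    obtain ⟨i, hi, hic, hzi⟩ := hzW
    linarith [(abs_le.1 (hreal i hi z ⟨hz, hzi⟩)).1]
  have hcov : K ⊆ V ∪ W := by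
    intro z hz
    obtain ⟨i, hi, hzi⟩ := mem_iUnion₂.1 (hKU hz)
    rcases hside i hi with h | h
    · left
      simp only [V, mem_iUnion]
      exact ⟨i, hi, h, hzi⟩
    · right
      simp only [W, mem_iUnion]
      exact ⟨i, hi, h, hzi⟩
  obtain ⟨z, hz, hzV, hzW⟩ := hK V W
    (isOpen_biUnion fun i hi => isOpen_iUnion fun _ => hU i hi)
    (isOpen_biUnion fun i hi => isOpen_iUnion fun _ => hU i hi) hcov
    ⟨x, hx, (hcov hx).resolve_right fun h => (hW x hx h).not_gt hc.1⟩
    ⟨y, hy, (hcov hy).resolve_left fun h => (hV y hy h).not_gt hc.2⟩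
  exact (hV z hz hzV).not_gt (hW z hz hzW)

/-- A compact set is covered by finitely many enlarged balls whose shrinkings are disjoint. -/
lemma IsCompact.exists_finset_disjoint_closedBall_cover {X : Type*} [PseudoMetricSpace X]
    {K : Set X} (hK : IsCompact K) (δ : X → ℝ) (hδ : ∀ p ∈ K, 0 < δ p) :
    ∃ P : Finset X, (P : Set X) ⊆ K ∧
      (P : Set X).PairwiseDisjoint (fun p => Metric.closedBall p (δ p / 200)) ∧
      K ⊆ ⋃ p ∈ P, Metric.ball p (δ p / 20) := by
  obtain ⟨t, htK, htc⟩ := hK.elim_nhds_subcover (fun p => Metric.ball p (δ p / 200))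
    fun p hp => Metric.ball_mem_nhds p (by linarith [hδ p hp])
  -- The sum of the finitely many radii is merely an upper bound for each. Enlargement by 5 gives
  -- δ/40, less than δ/20.
  obtain ⟨v, hvt, hvd, hvc⟩ := Vitali.exists_disjoint_subfamily_covering_enlargement_closedBall
    (t : Set X) id (fun p => δ p / 200) (∑ p ∈ t, δ p / 200)
    (fun p hp => Finset.single_le_sum (f := fun p => δ p / 200)
      (fun q hq => by linarith [hδ q (htK q hq)]) hp) 5 (by norm_num)
  have hvf : v.Finite := t.finite_toSet.subset hvt
  refine ⟨hvf.toFinset, ?_, ?_, ?_⟩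
  · intro p hp
    exact htK p (hvt (by simpa using hp))
  · simpa using hvd
  · intro z hz
    obtain ⟨p, hp, hzp⟩ := mem_iUnion₂.1 (htc hz)
    obtain ⟨q, hq, hpq⟩ := hvc p hp
    have hq0 := hδ q (htK q (hvt hq))
    refine mem_iUnion₂.2 ⟨q, by simpa using hq, ?_⟩
    exact Metric.closedBall_subset_ball (show 5 * (δ q / 200) < δ q / 20 by linarith)
      (hpq (Metric.ball_subset_closedBall hzp))

variable {n : ℕ} {D : Set (EuclideanSpace ℝ (Fin n))} {u : EuclideanSpace ℝ (Fin n) → ℝ}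
  {g : EuclideanSpace ℝ (Fin n) → EuclideanSpace ℝ (Fin n)}

/-- If y is in the half ball of p, the Lipschitz bound makes δ(p) comparable to δ(y). Hence disjoint
balls of radius δ(y)/300 lie in the ball of radius 2δ(y) about y, and the volume ratio is 600^n. -/
lemma card_filter_mem_ball_le {δ : EuclideanSpace ℝ (Fin n) → ℝ}
    (hδL : ∀ p q, |δ p - δ q| ≤ dist p q) (P : Finset (EuclideanSpace ℝ (Fin n)))
    (hδ : ∀ p ∈ P, 0 < δ p)
    (hP : (P : Set (EuclideanSpace ℝ (Fin n))).PairwiseDisjoint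
      (fun p => Metric.closedBall p (δ p / 200))) (y : EuclideanSpace ℝ (Fin n))
    [DecidablePred fun p => y ∈ Metric.ball p (δ p / 2)] :
    (P.filter fun p => y ∈ Metric.ball p (δ p / 2)).card ≤ 600 ^ n := by
  set s := P.filter fun p => y ∈ Metric.ball p (δ p / 2) with hs
  rcases s.eq_empty_or_nonempty with h0 | ⟨p₀, hp₀⟩
  · simp [h0]
  have hcomp : ∀ p ∈ s, δ p / 2 ≤ δ y ∧ δ y ≤ 3 / 2 * δ p ∧ dist y p < δ p / 2 ∧ 0 < δ p := by
    intro p hp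
    obtain ⟨hpP, hyp⟩ := Finset.mem_filter.1 hp
    rw [Metric.mem_ball] at hyp
    obtain ⟨h1, h2⟩ := abs_le.1 (hδL y p)
    exact ⟨by linarith, by linarith, hyp, hδ p hpP⟩
  have hy0 : 0 < δ y := by linarith [hcomp p₀ hp₀]
  have hdisj : (s : Set (EuclideanSpace ℝ (Fin n))).PairwiseDisjoint
      (fun p => Metric.closedBall p (δ y / 300)) := by
    intro p hp q hq hpq
    refine (hP (Finset.mem_filter.1 hp).1 (Finset.mem_filter.1 hq).1 hpq).mono ?_ ?_ <;>
      refine Metric.closedBall_subset_closedBall ?_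
    · linarith [hcomp p hp]
    · linarith [hcomp q hq]
  have hsub : (⋃ p ∈ s, Metric.closedBall p (δ y / 300)) ⊆ Metric.closedBall y (2 * δ y) := by
    refine iUnion₂_subset fun p hp => Metric.closedBall_subset_closedBall' ?_
    have := hcomp p hp
    rw [dist_comm p y]
    linarith
  have hvol := measureReal_mono (μ := volume) hsub measure_closedBall_lt_top.ne
  rw [measureReal_biUnion_finset hdisj (fun p _ => measurableSet_closedBall)
    (fun p _ => measure_closedBall_lt_top.ne)] at hvol
  have hV : 0 < (volume : Measure (EuclideanSpace ℝ (Fin n))).real (Metric.ball 0 1) :=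
    ENNReal.toReal_pos (Metric.measure_ball_pos _ _ one_pos).ne' measure_ball_lt_top.ne
  simp_rw [Measure.addHaar_real_closedBall (volume : Measure (EuclideanSpace ℝ (Fin n))) _
    (show 0 ≤ δ y / 300 by positivity), Measure.addHaar_real_closedBall
    (volume : Measure (EuclideanSpace ℝ (Fin n))) _ (show 0 ≤ 2 * δ y by positivity)] at hvol
  rw [Finset.sum_const, nsmul_eq_mul, ← mul_assoc, finrank_euclideanSpace_fin] at hvol
  have h1 := le_of_mul_le_mul_right hvol hV
  rw [show 2 * δ y = 600 * (δ y / 300) by ring, mul_pow] at h1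
  have h2 := le_of_mul_le_mul_right h1 (by positivity : 0 < (δ y / 300) ^ n)
  exact_mod_cast h2

lemma sum_setLIntegral_ball_le {δ : EuclideanSpace ℝ (Fin n) → ℝ}
    (hδL : ∀ p q, |δ p - δ q| ≤ dist p q) (P : Finset (EuclideanSpace ℝ (Fin n)))
    (hδ : ∀ p ∈ P, 0 < δ p)
    (hP : (P : Set (EuclideanSpace ℝ (Fin n))).PairwiseDisjoint
      (fun p => Metric.closedBall p (δ p / 200)))
    (hPD : ∀ p ∈ P, Metric.ball p (δ p / 2) ⊆ D) {f : EuclideanSpace ℝ (Fin n) → ℝ≥0∞}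
    (hf : AEMeasurable f (volume.restrict D)) :
    ∑ p ∈ P, ∫⁻ y in Metric.ball p (δ p / 2), f y ≤ 600 ^ n * ∫⁻ y in D, f y := by
  classical
  have h1 : ∀ p ∈ P, ∫⁻ y in Metric.ball p (δ p / 2), f y =
      ∫⁻ y in D, (Metric.ball p (δ p / 2)).indicator f y := fun p hp => by
    rw [lintegral_indicator measurableSet_ball, Measure.restrict_restrict measurableSet_ball,
      inter_eq_left.2 (hPD p hp)]
  rw [Finset.sum_congr rfl h1, ← lintegral_finsetSum' _ fun p _ => hf.indicator measurableSet_ball,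
    ← lintegral_const_mul' _ _ (by finiteness)]
  refine lintegral_mono fun y => ?_
  simp only [indicator_apply]
  rw [← Finset.sum_filter, Finset.sum_const, nsmul_eq_mul]
  gcongr
  exact_mod_cast card_filter_mem_ball_le hδL P hδ hP y

/-- The chaining estimate along a continuum `K`: the weight `k` dominates the kernel associated
with the Whitney balls centred on `K`. -/
theorem HasWeakGradient.abs_mollifiedMean_sub_le_of_isPreconnected (hn : 2 ≤ n)
    (h : HasWeakGradient D u g) (hD : MeasurableSet D)
    {δ : EuclideanSpace ℝ (Fin n) → ℝ} (hδL : ∀ p q, |δ p - δ q| ≤ dist p q)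
    (hδ : ∀ p ∈ D, 0 < δ p) (hδD : ∀ p ∈ D, Metric.ball p (δ p) ⊆ D)
    {K : Set (EuclideanSpace ℝ (Fin n))} (hK : IsCompact K) (hKp : IsPreconnected K)
    (hKD : K ⊆ D) {k : EuclideanSpace ℝ (Fin n) → ℝ≥0∞} (hkm : AEMeasurable k)
    (hk : ∀ p ∈ K, ∀ᵐ y, y ∈ Metric.ball p (δ p / 2) →
      ENNReal.ofReal ((δ p)⁻¹ ^ (n - 1)) ≤ k y)
    {x x' : EuclideanSpace ℝ (Fin n)} (hx : x ∈ K) (hx' : x' ∈ K) :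
    ENNReal.ofReal |mollifiedMean D u x (δ x / 4) - mollifiedMean D u x' (δ x' / 4)| ≤
      ENNReal.ofReal (2 * 3000 ^ n * mollifierBound n) * ∫⁻ y in D, ‖g y‖ₑ * k y := by
  have hM := mollifierBound_pos (n := n)
  obtain ⟨P, hPK, hPd, hPc⟩ := hK.exists_finset_disjoint_closedBall_cover δ
    fun p hp => hδ p (hKD hp)
  have hP0 : ∀ p ∈ P, 0 < δ p := fun p hp => hδ p (hKD (hPK hp))
  have hPD : ∀ p ∈ P, Metric.ball p (δ p / 2) ⊆ D := fun p hp =>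
    (Metric.ball_subset_ball (by linarith [hP0 p hp])).trans (hδD p (hKD (hPK hp)))
  -- Each covering ball costs 5^n times its weighted integral; the overlap 600^n and the factor 2 of
  -- the connectedness argument make up 2 · 3000^n.
  have hchain := hKp.abs_sub_le_two_mul_sum P (fun p => Metric.ball p (δ p / 20))
    (fun _ _ => Metric.isOpen_ball) hPc (fun p => mollifiedMean D u p (δ p / 4))
    (fun p => mollifiedMean D u p (δ p / 4))
    (fun p => ENNReal.ofReal (5 ^ n * mollifierBound n) *
      ∫⁻ y in Metric.ball p (δ p / 2), ‖g y‖ₑ * k y) ?_ hx hx'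
  · refine hchain.trans ?_
    rw [← Finset.mul_sum]
    have hsum := sum_setLIntegral_ball_le hδL P hP0 hPd hPD
      (h.locallyIntegrable_grad.aestronglyMeasurable.enorm.mul hkm.restrict)
    calc _ ≤ 2 * (ENNReal.ofReal (5 ^ n * mollifierBound n) *
          (600 ^ n * ∫⁻ y in D, ‖g y‖ₑ * k y)) := by gcongr; exact hsum
      _ = _ := by
        generalize ∫⁻ y in D, ‖g y‖ₑ * k y = I
        rw [← mul_assoc, ← mul_assoc, show (2 : ℝ≥0∞) = ENNReal.ofReal 2 by simp,
          show (600 : ℝ≥0∞) ^ n = ENNReal.ofReal (600 ^ n) by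
            rw [ENNReal.ofReal_pow (by norm_num)]; simp,
          ← ENNReal.ofReal_mul (by norm_num), ← ENNReal.ofReal_mul (by positivity)]
        congr 2
        rw [show (3000 : ℝ) = 5 * 600 by norm_num, mul_pow]
        ring
  · rintro p hp z ⟨hzK, hzp⟩
    have hzp' : dist z p < δ p / 20 := hzp
    refine (h.abs_mollifiedMean_sub_le_of_dist_le hn hD (hP0 p hp) (hδD p (hKD (hPK hp))) hzp'.le
      ((hδL z p).trans hzp'.le)).trans ?_
    rw [ENNReal.ofReal_mul (by positivity), mul_assoc]
    gcongr
    rw [← lintegral_const_mul' _ _ ENNReal.ofReal_ne_top]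
    refine lintegral_mono_ae ((ae_restrict_iff' measurableSet_ball).2 ?_)
    filter_upwards [hk p (hPK hp)] with y hy hyp
    rw [mul_comm]
    gcongr
    exact hy hyp

end Chain

/-! ### From the mollified mean to the average over a ball. -/

section BallAverage

variable {n : ℕ} {D : Set (EuclideanSpace ℝ (Fin n))} {u : EuclideanSpace ℝ (Fin n) → ℝ}
  {g : EuclideanSpace ℝ (Fin n) → EuclideanSpace ℝ (Fin n)}

/-- The integral of the Riesz kernel `5 ^ n * mollifierBound n * ‖x‖ ^ (1 - n)` over the ball with
radius `R` centred at the origin. -/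
noncomputable def rieszKernelMass (n : ℕ) (R : ℝ) : ℝ≥0∞ :=
  ∫⁻ x in Metric.ball (0 : EuclideanSpace ℝ (Fin n)) R,
    ENNReal.ofReal (5 ^ n * mollifierBound n * ‖x‖⁻¹ ^ (n - 1))

/-- In polar coordinates the Jacobian t^(n-1) cancels the singularity. -/
lemma rieszKernelMass_lt_top (hn : 2 ≤ n) (R : ℝ) : rieszKernelMass n R < ⊤ := by
  have : Nontrivial (Fin n) := Fin.nontrivial_iff_two_le.2 hn
  have h : IntegrableOn (fun x : EuclideanSpace ℝ (Fin n) =>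
      5 ^ n * mollifierBound n * ‖x‖⁻¹ ^ (n - 1)) (Metric.ball 0 R) := by
    rw [integrableOn_fun_norm_addHaar volume
      (f := fun t : ℝ => 5 ^ n * mollifierBound n * t⁻¹ ^ (n - 1)), finrank_euclideanSpace_fin]
    refine IntegrableOn.congr_fun (f := fun _ : ℝ => 5 ^ n * mollifierBound n)
      (integrableOn_const measure_Ioo_lt_top.ne) (fun t ht => ?_) measurableSet_Ioo
    have : t ^ (n - 1) ≠ 0 := pow_ne_zero _ ht.1.ne'
    simp only [smul_eq_mul, inv_pow]
    field_simp
  exact h.lintegral_lt_top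

lemma setLIntegral_rieszKernel_le {y z : EuclideanSpace ℝ (Fin n)} {r : ℝ}
    (hy : y ∈ Metric.ball z r) :
    ∫⁻ x in Metric.ball z r,
      ENNReal.ofReal (5 ^ n * mollifierBound n * (dist x y)⁻¹ ^ (n - 1)) ≤
      rieszKernelMass n (2 * r) := by
  have hsub : Metric.ball z r ⊆ Metric.ball y (2 * r) := by
    refine Metric.ball_subset_ball' ?_
    have : dist y z < r := hy
    rw [dist_comm]
    linarith
  refine (lintegral_mono_set hsub).trans (le_of_eq ?_)
  rw [rieszKernelMass, ← lintegral_indicator measurableSet_ball,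
    ← lintegral_indicator measurableSet_ball]
  conv_rhs => rw [← lintegral_sub_right_eq_self _ y]
  refine lintegral_congr fun x => ?_
  simp only [indicator, Metric.mem_ball, dist_eq_norm, sub_zero]

/-- Integrate the pointwise Riesz bound over x and apply Tonelli. This is where that bound is needed
at every point of the ball, not only at its centre. -/
lemma HasWeakGradient.lintegral_enorm_sub_mollifiedMean_le (hn : 2 ≤ n)
    (h : HasWeakGradient D u g) (hD : IsOpen D) {z : EuclideanSpace ℝ (Fin n)} {r : ℝ}
    (hr : 0 < r) (hball : Metric.ball z r ⊆ D) :
    ∫⁻ x in Metric.ball z r, ‖u x - mollifiedMean D u z (r / 4)‖ₑ ≤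
      rieszKernelMass n (2 * r) * ∫⁻ y in Metric.ball z r, ‖g y‖ₑ := by
  have hL : ∀ᵐ x ∂(volume.restrict (Metric.ball z r)), IsLebesguePoint u x :=
    ae_restrict_of_ae_restrict_of_subset hball (h.locallyIntegrable.ae_isLebesguePoint hD)
  have hgm : AEStronglyMeasurable g (volume.restrict (Metric.ball z r)) :=
    h.locallyIntegrable_grad.aestronglyMeasurable.mono_measure (Measure.restrict_mono_set _ hball)
  calc _ ≤ ∫⁻ x in Metric.ball z r, ∫⁻ y in Metric.ball z r, ‖g y‖ₑ *
        ENNReal.ofReal (5 ^ n * mollifierBound n * (dist x y)⁻¹ ^ (n - 1)) := by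
        refine lintegral_mono_ae ?_
        filter_upwards [hL, ae_restrict_mem measurableSet_ball] with x hxL hx
        rw [Real.enorm_eq_ofReal_abs]
        exact h.abs_sub_mollifiedMean_le hn hD.measurableSet hr hball hx hxL
    _ = ∫⁻ y in Metric.ball z r, ∫⁻ x in Metric.ball z r, ‖g y‖ₑ *
        ENNReal.ofReal (5 ^ n * mollifierBound n * (dist x y)⁻¹ ^ (n - 1)) := by
        refine lintegral_lintegral_swap (AEMeasurable.mul hgm.enorm.comp_snd ?_)
        exact Measurable.aemeasurable (by fun_prop)
    _ ≤ ∫⁻ y in Metric.ball z r, rieszKernelMass n (2 * r) * ‖g y‖ₑ := by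
        refine setLIntegral_mono' measurableSet_ball fun y hy => ?_
        rw [lintegral_const_mul' _ _ enorm_ne_top, mul_comm]
        gcongr
        exact setLIntegral_rieszKernel_le hy
    _ = _ := lintegral_const_mul' _ _ (rieszKernelMass_lt_top hn _).ne

lemma HasWeakGradient.integrableOn_ball (hn : 2 ≤ n) (h : HasWeakGradient D u g)
    (hD : IsOpen D) {z : EuclideanSpace ℝ (Fin n)} {r : ℝ} (hr : 0 < r)
    (hball : Metric.ball z r ⊆ D) (hg : IntegrableOn g (Metric.ball z r)) :
    IntegrableOn u (Metric.ball z r) := by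
  have hm : AEStronglyMeasurable u (volume.restrict (Metric.ball z r)) :=
    h.locallyIntegrable.aestronglyMeasurable.mono_measure (Measure.restrict_mono_set _ hball)
  have h1 : IntegrableOn (fun x => u x - mollifiedMean D u z (r / 4)) (Metric.ball z r) :=
    ⟨hm.sub aestronglyMeasurable_const,
      (h.lintegral_enorm_sub_mollifiedMean_le hn hD hr hball).trans_lt
        (ENNReal.mul_lt_top (rieszKernelMass_lt_top hn _) hg.2)⟩
  have h2 := h1.add (integrableOn_const (C := mollifiedMean D u z (r / 4))
    (measure_ball_lt_top (x := z) (r := r)).ne)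
  exact h2.congr_fun (fun x _ => by simp) measurableSet_ball

/-- The constant in the comparison of the mean over a ball with radius `r` and the mollified
mean. -/
noncomputable def ballMeanConst (n : ℕ) (r : ℝ) : ℝ :=
  ((volume (Metric.ball (0 : EuclideanSpace ℝ (Fin n)) r))⁻¹ * rieszKernelMass n (2 * r)).toReal

lemma HasWeakGradient.abs_mollifiedMean_sub_average_le (hn : 2 ≤ n) (h : HasWeakGradient D u g)
    (hD : IsOpen D) {z : EuclideanSpace ℝ (Fin n)} {r : ℝ} (hr : 0 < r)
    (hball : Metric.ball z r ⊆ D) (hu : IntegrableOn u (Metric.ball z r)) :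
    ENNReal.ofReal |mollifiedMean D u z (r / 4) - ⨍ y in Metric.ball z r, u y| ≤
      ENNReal.ofReal (ballMeanConst n r) * ∫⁻ y in Metric.ball z r, ‖g y‖ₑ := by
  set a := mollifiedMean D u z (r / 4)
  have hv0 : volume (Metric.ball z r) ≠ 0 := (Metric.measure_ball_pos _ _ hr).ne'
  have hvt : volume (Metric.ball z r) ≠ ⊤ := measure_ball_lt_top.ne
  have hav : a - ⨍ y in Metric.ball z r, u y =
      -(volume.real (Metric.ball z r))⁻¹ * ∫ y in Metric.ball z r, (u y - a) := by
    have hv : volume.real (Metric.ball z r) ≠ 0 := (ENNReal.toReal_pos hv0 hvt).ne'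
    rw [integral_sub hu (integrableOn_const hvt), setAverage_eq, setIntegral_const]
    simp only [smul_eq_mul]
    field_simp
    ring
  have hvol : volume (Metric.ball z r) =
      volume (Metric.ball (0 : EuclideanSpace ℝ (Fin n)) r) :=
    Measure.addHaar_ball_center volume z r
  rw [hav, ← Real.enorm_eq_ofReal_abs, enorm_mul, enorm_neg, ballMeanConst,
    ENNReal.ofReal_toReal, mul_assoc]
  · refine mul_le_mul' ?_ ((enorm_integral_le_lintegral_enorm _).trans
      (h.lintegral_enorm_sub_mollifiedMean_le hn hD hr hball))
    rw [Real.enorm_eq_ofReal (by positivity), Measure.real, ← ENNReal.toReal_inv,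
      ENNReal.ofReal_toReal (ENNReal.inv_ne_top.2 hv0), hvol]
  · exact ENNReal.mul_ne_top (ENNReal.inv_ne_top.2 (hvol ▸ hv0)) (rieszKernelMass_lt_top hn _).ne

end BallAverage

/-! ### Distance to the boundary, unit speed curves, power inequalities. -/

section JohnDomain

variable {n : ℕ} {D : Set (EuclideanSpace ℝ (Fin n))}

/-- Needed because `Metric.infDist` to the empty set is 0. -/
lemma Bornology.IsBounded.frontier_nonempty (hn : 2 ≤ n) (hb : Bornology.IsBounded D)
    (hne : D.Nonempty) : (frontier D).Nonempty := by
  have : Nontrivial (Fin n) := Fin.nontrivial_iff_two_le.2 hn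
  refine nonempty_frontier_iff.2 ⟨hne, ?_⟩
  rintro rfl
  exact NormedSpace.unbounded_univ ℝ (EuclideanSpace ℝ (Fin n)) hb

lemma IsOpen.infDist_frontier_pos (hD : IsOpen D) (hf : (frontier D).Nonempty)
    {p : EuclideanSpace ℝ (Fin n)} (hp : p ∈ D) : 0 < Metric.infDist p (frontier D) :=
  (isClosed_frontier.notMem_iff_infDist_pos hf).1 fun h => (hD.frontier_eq ▸ h).2 hp

lemma IsOpen.ball_infDist_frontier_subset (hD : IsOpen D) {p : EuclideanSpace ℝ (Fin n)}
    (hp : p ∈ D) : Metric.ball p (Metric.infDist p (frontier D)) ⊆ D := by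
  rcases le_or_gt (Metric.infDist p (frontier D)) 0 with h0 | h0
  · rw [Metric.ball_eq_empty.2 h0]
    exact empty_subset _
  refine ((convex_ball p _).isPreconnected).subset_of_closure_inter_subset hD
    ⟨p, Metric.mem_ball_self h0, hp⟩ fun y ⟨hyc, hyb⟩ => ?_
  by_contra hyD
  have hyf : y ∈ frontier D := hD.frontier_eq ▸ ⟨hyc, hyD⟩
  have := Metric.infDist_le_dist_of_mem (x := p) hyf
  rw [Metric.mem_ball, dist_comm] at hyb
  linarith

lemma abs_infDist_sub_infDist_le_dist {X : Type*} [PseudoMetricSpace X] (s : Set X) (p q : X) :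
    |Metric.infDist p s - Metric.infDist q s| ≤ dist p q := by
  rw [abs_le]
  constructor
  · linarith [Metric.infDist_le_infDist_add_dist (s := s) (x := q) (y := p), dist_comm p q]
  · linarith [Metric.infDist_le_infDist_add_dist (s := s) (x := p) (y := q)]

lemma HasUnitSpeedOn.dist_le {X : Type*} [PseudoMetricSpace X] {γ : ℝ → X} {I : Set ℝ}
    (h : HasUnitSpeedOn γ I) {a b : ℝ} (ha : a ∈ I) (hb : b ∈ I) (hab : a ≤ b) :
    dist (γ a) (γ b) ≤ b - a := by
  have h1 := h ha hb
  have h2 := eVariationOn.edist_le γ (s := I ∩ Icc a b) ⟨ha, le_rfl, hab⟩ ⟨hb, hab, le_rfl⟩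
  rw [h1, NNReal.coe_one, one_mul, edist_dist] at h2
  exact (ENNReal.ofReal_le_ofReal_iff (by linarith)).1 h2

lemma HasUnitSpeedOn.continuousOn {X : Type*} [PseudoMetricSpace X] {γ : ℝ → X} {I : Set ℝ}
    (h : HasUnitSpeedOn γ I) : ContinuousOn γ I := by
  refine LipschitzOnWith.continuousOn (K := 1) (LipschitzOnWith.of_dist_le_mul fun a ha b hb => ?_)
  rw [NNReal.coe_one, one_mul, Real.dist_eq]
  rcases le_total a b with hab | hab
  · exact (h.dist_le ha hb hab).trans (by rw [abs_sub_comm]; exact le_abs_self _)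
  · rw [dist_comm]
    exact (h.dist_le hb ha hab).trans (le_abs_self _)

lemma inv_pow_le_div_rpow (hn : 2 ≤ n) {ρ δ s A : ℝ} (hρ : 0 < ρ) (hδ : 0 < δ)
    (h : ρ ^ s ≤ A * δ) : δ⁻¹ ^ (n - 1) ≤ A ^ (n - 1) / ρ ^ (s * ((n : ℝ) - 1)) := by
  have e : ((n : ℝ) - 1) = ((n - 1 : ℕ) : ℝ) := by
    rw [Nat.cast_sub (by omega)]
    simp
  rw [e, Real.rpow_mul hρ.le, Real.rpow_natCast, le_div_iff₀ (by positivity), inv_pow,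
    inv_mul_eq_div, div_le_iff₀ (by positivity), ← mul_pow]
  gcongr

/-- Write ρ^s = ρ^(s-1) ρ and use s ≥ 1; taking R ≥ 1 leaves a constant that depends on s only
through S. -/
lemma rpow_le_rpow_mul_self {ρ R s S : ℝ} (hρ : 0 < ρ) (hρR : ρ ≤ R) (hR : 1 ≤ R) (hs : 1 ≤ s)
    (hsS : s ≤ S) : ρ ^ s ≤ R ^ S * ρ := by
  calc ρ ^ s = ρ ^ (s - 1) * ρ := by
        rw [← Real.rpow_add_one hρ.ne', sub_add_cancel]
    _ ≤ R ^ (s - 1) * ρ := by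
        gcongr
    _ ≤ R ^ S * ρ := by
        gcongr
        · linarith

/-- Up to a factor 2, ρ is at most t or at most δ. In the first case the John condition applies; in
the second s ≥ 1 and the bound on δ give δ^s ≤ R^S δ. -/
lemma rpow_le_of_john {ρ t δ R B s S : ℝ} (hρ : 0 < ρ) (ht : 0 ≤ t) (hδ : 0 < δ)
    (hδR : δ ≤ R) (hR : 1 ≤ R) (hs : 1 ≤ s) (hsS : s ≤ S) (hjohn : t ^ s ≤ B * δ)
    (hρt : ρ ≤ t + δ / 2) : ρ ^ s ≤ 2 ^ S * (B + R ^ S) * δ := by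
  have h1 : (max t δ) ^ s ≤ t ^ s + δ ^ s := by
    rcases max_cases t δ with ⟨h, _⟩ | ⟨h, _⟩ <;> rw [h]
    · linarith [Real.rpow_nonneg hδ.le s]
    · linarith [Real.rpow_nonneg ht s]
  have h2 := rpow_le_rpow_mul_self hδ hδR hR hs hsS
  have h3 : ρ ≤ 2 * max t δ := by linarith [le_max_left t δ, le_max_right t δ]
  have hR0 : 0 ≤ R ^ S := Real.rpow_nonneg (by linarith) _
  calc ρ ^ s ≤ (2 * max t δ) ^ s := by gcongr
    _ = 2 ^ s * (max t δ) ^ s := Real.mul_rpow (by norm_num) (le_max_of_le_left ht)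
    _ ≤ 2 ^ S * ((B + R ^ S) * δ) := by
        gcongr
        · norm_num
        · linarith
    _ = _ := by ring

end JohnDomain

/-! ### Kernel comparisons and chaining in a John domain. -/

section JohnDomain

variable {n : ℕ} {D : Set (EuclideanSpace ℝ (Fin n))} {s : EuclideanSpace ℝ (Fin n) → ℝ}
  {α β : ℝ} {x₀ : EuclideanSpace ℝ (Fin n)} {u : EuclideanSpace ℝ (Fin n) → ℝ}
  {g : EuclideanSpace ℝ (Fin n) → EuclideanSpace ℝ (Fin n)}

lemma variableRieszPotential_norm_eq (D : Set (EuclideanSpace ℝ (Fin n)))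
    (s : EuclideanSpace ℝ (Fin n) → ℝ) (g : EuclideanSpace ℝ (Fin n) → EuclideanSpace ℝ (Fin n))
    (x : EuclideanSpace ℝ (Fin n)) :
    variableRieszPotential D s (fun y => ‖g y‖) x =
      ∫⁻ y in D, ‖g y‖ₑ * ENNReal.ofReal (1 / dist x y ^ (s x * ((n : ℝ) - 1))) := by
  refine lintegral_congr fun y => ?_
  rw [abs_norm, div_eq_mul_one_div, ENNReal.ofReal_mul (norm_nonneg _), ofReal_norm]

lemma ofReal_div_rpow {A : ℝ} (hA : 0 ≤ A) (a b : ℝ) :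
    ENNReal.ofReal (A / a ^ b) = ENNReal.ofReal A * ENNReal.ofReal (1 / a ^ b) := by
  rw [← ENNReal.ofReal_mul hA, mul_one_div]

namespace IsVariableJohnDomain

lemma dist_center_le (hJ : IsVariableJohnDomain D s α β x₀) {x : EuclideanSpace ℝ (Fin n)}
    (hx : x ∈ D) : dist x x₀ ≤ β := by
  obtain ⟨ℓ, γ, h0, hℓ, hγ, -, rfl, rfl, -⟩ := hJ.exists_curve x hx
  linarith [hγ.dist_le (left_mem_Icc.2 h0) (right_mem_Icc.2 h0) h0]

lemma dist_le (hJ : IsVariableJohnDomain D s α β x₀) {x y : EuclideanSpace ℝ (Fin n)}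
    (hx : x ∈ D) (hy : y ∈ D) : dist x y ≤ 2 * β := by
  linarith [dist_triangle_right x y x₀, hJ.dist_center_le hx, hJ.dist_center_le hy]

/-- The Riesz kernel is dominated by the kernel with variable exponent. -/
lemma setLIntegral_riesz_le (hJ : IsVariableJohnDomain D s α β x₀) (hn : 2 ≤ n) {S : ℝ}
    {x : EuclideanSpace ℝ (Fin n)} (hx : x ∈ D) (hxS : s x ≤ S) {E : Set (EuclideanSpace ℝ (Fin n))}
    (hE : MeasurableSet E) (hED : E ⊆ D) {A : ℝ} (hA : 0 ≤ A) :
    ∫⁻ y in E, ‖g y‖ₑ * ENNReal.ofReal (A * (dist x y)⁻¹ ^ (n - 1)) ≤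
      ENNReal.ofReal (A * ((2 * β + 1) ^ S) ^ (n - 1)) *
        variableRieszPotential D s (fun y => ‖g y‖) x := by
  have hβ : 0 < β := hJ.pos.trans_le hJ.le
  rw [variableRieszPotential_norm_eq, ← lintegral_const_mul' _ _ ENNReal.ofReal_ne_top]
  refine (lintegral_mono_ae ?_).trans (lintegral_mono_set hED)
  filter_upwards [ae_restrict_mem hE,
    ae_ne_of_two_le hn _ Measure.restrict_le_self.absolutelyContinuous x] with y hy hxy
  have hρ : 0 < dist x y := dist_pos.2 hxy
  have h1 := inv_pow_le_div_rpow hn hρ hρ (rpow_le_rpow_mul_self hρ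
    (show dist x y ≤ 2 * β + 1 by linarith [hJ.dist_le hx (hED hy)]) (by linarith)
    (hJ.one_le x hx) hxS)
  rw [mul_left_comm, ← ofReal_div_rpow (by positivity)]
  gcongr
  rw [mul_div_assoc]
  gcongr

/-- Since D has diameter at most 2β, the factor ((2β + 1)/|x - y|)^(n-1) is at least 1 and may be
inserted under the integral. -/
lemma setLIntegral_enorm_le (hJ : IsVariableJohnDomain D s α β x₀) (hn : 2 ≤ n) {S : ℝ}
    {x : EuclideanSpace ℝ (Fin n)} (hx : x ∈ D) (hxS : s x ≤ S) {E : Set (EuclideanSpace ℝ (Fin n))}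
    (hE : MeasurableSet E) (hED : E ⊆ D) :
    ∫⁻ y in E, ‖g y‖ₑ ≤ ENNReal.ofReal ((2 * β + 1) ^ (n - 1) * ((2 * β + 1) ^ S) ^ (n - 1)) *
        variableRieszPotential D s (fun y => ‖g y‖) x := by
  have hβ : 0 < β := hJ.pos.trans_le hJ.le
  refine le_trans (lintegral_mono_ae ?_) (hJ.setLIntegral_riesz_le hn hx hxS hE hED
    (show 0 ≤ (2 * β + 1) ^ (n - 1) by positivity))
  filter_upwards [ae_restrict_mem hE,
    ae_ne_of_two_le hn _ Measure.restrict_le_self.absolutelyContinuous x] with y hy hxy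
  have hρ : 0 < dist x y := dist_pos.2 hxy
  refine le_mul_of_one_le_right' ?_
  rw [ENNReal.one_le_ofReal, ← mul_pow, ← div_eq_mul_inv]
  refine one_le_pow₀ ((one_le_div hρ).2 ?_)
  linarith [hJ.dist_le hx (hED hy)]

/-- Chaining along the image of the John curve of x. There δ is at most d + β, as the distance to
the boundary is 1-Lipschitz and D lies within β of x₀; this gives the constant R = d + β + 1. -/
lemma abs_mollifiedMean_sub_center_le (hJ : IsVariableJohnDomain D s α β x₀) (hn : 2 ≤ n)
    (hu : HasWeakGradient D u g) {S : ℝ} {x : EuclideanSpace ℝ (Fin n)} (hx : x ∈ D)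
    (hxS : s x ≤ S) :
    ENNReal.ofReal |mollifiedMean D u x (Metric.infDist x (frontier D) / 4) -
        mollifiedMean D u x₀ (Metric.infDist x₀ (frontier D) / 4)| ≤
      ENNReal.ofReal (2 * 3000 ^ n * mollifierBound n *
        (2 ^ S * (β / α + (Metric.infDist x₀ (frontier D) + β + 1) ^ S)) ^ (n - 1)) *
        variableRieszPotential D s (fun y => ‖g y‖) x := by
  have hα := hJ.pos
  have hβ : 0 < β := hα.trans_le hJ.le
  have hM := mollifierBound_pos (n := n)
  have hf := hJ.isBounded.frontier_nonempty hn ⟨x₀, hJ.center_mem⟩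
  obtain ⟨ℓ, γ, h0, hℓ, hγ, hγD, hγ0, hγℓ, hjohn⟩ := hJ.exists_curve x hx
  set d := Metric.infDist x₀ (frontier D) with hd
  have hd0 : 0 ≤ d := Metric.infDist_nonneg
  set A := 2 ^ S * (β / α + (d + β + 1) ^ S) with hA
  have hA0 : 0 ≤ A := by positivity
  have hkey := hu.abs_mollifiedMean_sub_le_of_isPreconnected hn hJ.isOpen.measurableSet
    (δ := fun p => Metric.infDist p (frontier D)) (abs_infDist_sub_infDist_le_dist _)
    (fun p hp => hJ.isOpen.infDist_frontier_pos hf hp)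
    (fun p hp => hJ.isOpen.ball_infDist_frontier_subset hp)
    (isCompact_Icc.image_of_continuousOn hγ.continuousOn)
    (isPreconnected_Icc.image γ hγ.continuousOn) hγD.image_subset
    (k := fun y => ENNReal.ofReal (A ^ (n - 1) / dist x y ^ (s x * ((n : ℝ) - 1))))
    (Measurable.aemeasurable (by fun_prop)) ?_
    ⟨0, left_mem_Icc.2 h0, hγ0⟩ ⟨ℓ, right_mem_Icc.2 h0, hγℓ⟩
  · refine hkey.trans (le_of_eq ?_)
    rw [variableRieszPotential_norm_eq,
      ENNReal.ofReal_mul (p := 2 * 3000 ^ n * mollifierBound n) (by positivity),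
      mul_assoc (ENNReal.ofReal _), ← lintegral_const_mul' (ENNReal.ofReal (A ^ (n - 1))) _
      ENNReal.ofReal_ne_top]
    congr 1
    refine lintegral_congr fun y => ?_
    rw [ofReal_div_rpow (by positivity), mul_left_comm]
  · rintro p ⟨t, ht, rfl⟩
    filter_upwards [ae_ne_of_two_le hn volume Measure.AbsolutelyContinuous.rfl x] with y hxy hy
    have hδ := hJ.isOpen.infDist_frontier_pos hf (hγD ht)
    refine ENNReal.ofReal_le_ofReal (inv_pow_le_div_rpow hn (dist_pos.2 hxy) hδ ?_)
    refine rpow_le_of_john (dist_pos.2 hxy) ht.1 hδ ?_ (by linarith) (hJ.one_le x hx) hxS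
      (hjohn t ht) ?_
    · have h1 := Metric.infDist_le_infDist_add_dist (s := frontier D) (x := γ t) (y := x₀)
      have h2 := hJ.dist_center_le (hγD ht)
      linarith
    · have h1 := hγ.dist_le (left_mem_Icc.2 h0) ht ht.1
      rw [hγ0] at h1
      have h2 : dist y (γ t) < Metric.infDist (γ t) (frontier D) / 2 := hy
      linarith [dist_triangle_right x y (γ t)]

end IsVariableJohnDomain

end JohnDomain

/-! ### The pointwise estimate. -/

theorem mainTheorem7 (n : ℕ) (hn : 2 ≤ n) (α β S d : ℝ) :
    ∃ c : ℝ, 0 < c ∧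
      ∀ (D : Set (EuclideanSpace ℝ (Fin n))) (s : EuclideanSpace ℝ (Fin n) → ℝ)
        (x₀ : EuclideanSpace ℝ (Fin n)),
        IsVariableJohnDomain D s α β x₀ →
        (∀ᵐ x ∂(volume.restrict D), s x ≤ S) →
        Metric.infDist x₀ (frontier D) = d →
        ∀ (u : EuclideanSpace ℝ (Fin n) → ℝ)
          (g : EuclideanSpace ℝ (Fin n) → EuclideanSpace ℝ (Fin n)),
          MemL11WithGradient D u g →
          IntegrableOn u (Metric.ball x₀ d) ∧
          ∀ᵐ x ∂(volume.restrict D),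
            ENNReal.ofReal |u x - ⨍ y in Metric.ball x₀ d, u y| ≤
              ENNReal.ofReal c * variableRieszPotential D s (fun y => ‖g y‖) x := by
  -- The constant precedes the domain; parameters admitting no John domain are dealt with by c = 1.
  by_cases hpar : 0 < α ∧ α ≤ β ∧ 0 ≤ d
  swap
  · refine ⟨1, one_pos, fun D s x₀ hJ _ hd => (hpar ⟨hJ.pos, hJ.le, ?_⟩).elim⟩
    exact hd ▸ Metric.infDist_nonneg
  obtain ⟨hα, hαβ, hd0⟩ := hpar
  have hβ : 0 < β := hα.trans_le hαβ
  have hM := mollifierBound_pos (n := n)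
  have hB : 0 ≤ ballMeanConst n d := ENNReal.toReal_nonneg
  set c₁ : ℝ := 5 ^ n * mollifierBound n * ((2 * β + 1) ^ S) ^ (n - 1) with hc₁
  set c₂ : ℝ := 2 * 3000 ^ n * mollifierBound n *
    (2 ^ S * (β / α + (d + β + 1) ^ S)) ^ (n - 1) with hc₂
  set c₃ : ℝ := (2 * β + 1) ^ (n - 1) * ((2 * β + 1) ^ S) ^ (n - 1) with hc₃
  have hc₁0 : 0 < c₁ := by positivity
  have hc₂0 : 0 ≤ c₂ := by positivity
  have hc₃0 : 0 ≤ c₃ := by positivity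
  -- `c₁` pays for shrinking to x, `c₂` for the chain from x to x₀, and the last term for passing
  -- from the mollified mean at x₀ to u_B.
  refine ⟨c₁ + c₂ + ballMeanConst n d * c₃, by positivity, ?_⟩
  intro D s x₀ hJ hS hd u g hug
  have hu := hug.hasWeakGradient
  have hD := hJ.isOpen
  have hf := hJ.isBounded.frontier_nonempty hn ⟨x₀, hJ.center_mem⟩
  have hball : Metric.ball x₀ d ⊆ D := hd ▸ hD.ball_infDist_frontier_subset hJ.center_mem
  have hdpos : 0 < d := hd ▸ hD.infDist_frontier_pos hf hJ.center_mem
  have huB : IntegrableOn u (Metric.ball x₀ d) :=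
    hu.integrableOn_ball hn hD hdpos hball (hug.integrable_grad.mono_set hball)
  refine ⟨huB, ?_⟩
  filter_upwards [hS, hu.locallyIntegrable.ae_isLebesguePoint hD,
    ae_restrict_mem hD.measurableSet] with x hxS hxL hxD
  have hδ := hD.infDist_frontier_pos hf hxD
  have hballx := hD.ball_infDist_frontier_subset hxD
  have h1 := (hu.abs_sub_mollifiedMean_le hn hD.measurableSet hδ hballx (Metric.mem_ball_self hδ)
    hxL).trans (hJ.setLIntegral_riesz_le hn hxD hxS measurableSet_ball hballx (by positivity))
  have h2 := hJ.abs_mollifiedMean_sub_center_le hn hu hxD hxS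
  have h3 := hu.abs_mollifiedMean_sub_average_le hn hD hdpos hball huB
  have h4 := hJ.setLIntegral_enorm_le (g := g) hn hxD hxS measurableSet_ball hball
  rw [hd, ← hc₂] at h2
  rw [← hc₁] at h1
  rw [← hc₃] at h4
  set a := mollifiedMean D u x (Metric.infDist x (frontier D) / 4)
  set b := mollifiedMean D u x₀ (d / 4)
  have htri : |u x - ⨍ y in Metric.ball x₀ d, u y| ≤
      |u x - a| + |a - b| + |b - ⨍ y in Metric.ball x₀ d, u y| :=
    (abs_sub_le _ b _).trans (by gcongr; exact abs_sub_le _ _ _)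
  calc _ ≤ ENNReal.ofReal |u x - a| + ENNReal.ofReal |a - b| +
        ENNReal.ofReal |b - ⨍ y in Metric.ball x₀ d, u y| := by
        rw [← ENNReal.ofReal_add (by positivity) (by positivity),
          ← ENNReal.ofReal_add (by positivity) (by positivity)]
        exact ENNReal.ofReal_le_ofReal htri
    _ ≤ _ := by
        rw [ENNReal.ofReal_add (by positivity) (by positivity),
          ENNReal.ofReal_add hc₁0.le hc₂0, ENNReal.ofReal_mul hB, add_mul, add_mul, mul_assoc]
        gcongr
        exact h3.trans (by gcongr)
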